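/- Let $\overline{\mathbb Q}$ be the algebraic closure of $\mathbb Q$. Let $\mathbb G_m^2(\overline{\mathbb Q})=(\overline{\mathbb Q}^\times)^2$ act on $\mathbb P^2(\overline{\mathbb Q})$ by $(\gamma_1,\gamma_2)\cdot[\xi_0:\xi_1:\xi_2]=[\xi_0:\gamma_1\xi_1:\gamma_2\xi_2]$, and let $C\subset\mathbb P^2(\overline{\mathbb Q})$ be the line $x_0+x_1+x_2=0$. Denote by $\mathrm h$ the absolute logarithmic Weil height on $\mathbb P^2(\overline{\mathbb Q})$, that is $$\mathrm h([\xi_0:\xi_1:\xi_2])=\sum_{w}\frac{[K_w:\mathbb Q_v]}{[K:\mathbb Q]}\,\log\max(|\xi_0|_w,|\xi_1|_w,|\xi_2|_w)$$ for any number field $K$ containing the homogeneous coordinates $\xi_i$, where $w$ runs over the places of $K$, $v$ is the place of $\mathbb Q$ below $w$, and $|\cdot|_w$ extends the standard absolute value $|\cdot|_v$. A sequence in $\mathbb G_m^2(\overline{\mathbb Q})$ is called strict if it eventually avoids every fixed proper algebraic subgroup of $\mathbb G_m^2(\overline{\mathbb Q})$. Theorem. Let $(\omega_\ell)_{\ell}$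 be a strict sequence in $\mathbb G_m^2(\overline{\mathbb Q})$ of nontrivial torsion points (i.e. $\omega_\ell\neq(1,1)$ is of finite order for every $\ell$). Then, for every $\ell$, the intersection $C\cap\omega_\ell C$ consists of exactly one point, and $$\lim_{\ell\to+\infty}\mathrm h(C\cap\omega_\ell C)=\eta,\qquad\text{where } \eta=\frac{2\,\zeta(3)}{3\,\zeta(2)}=0.487175\dots$$ and $\zeta$ is the Riemann zeta function. -/

import Mathlib

open scoped LinearAlgebra.Projectivization Topology

/-- The algebraic closure `ℚ̄` of `ℚ`. -/
abbrev Qbar : Type := AlgebraicClosure ℚ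

/-- `ℚ̄` is an algebraic closure of `ℚ` for the canonical `ℚ`-algebra structure of a division ring of
characteristic zero, which is the one that instance search finds. -/
instance Qbar_isAlgClosure : IsAlgClosure ℚ Qbar := by
  have h : ∀ a b : Algebra ℚ Qbar, @IsAlgClosure ℚ Qbar _ _ a _ → @IsAlgClosure ℚ Qbar _ _ b _ := by
    intro a b hab
    rwa [Subsingleton.elim b a]
  exact h (AlgebraicClosure.instAlgebra ℚ) _ inferInstance

instance Qbar_isAlgebraic : Algebra.IsAlgebraic ℚ Qbar := IsAlgClosure.isAlgebraic

/-- The split torus `𝔾ₘⁿ(ℚ̄) = (ℚ̄ˣ)ⁿ`, a group under coordinatewise multiplication. -/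
abbrev Torus (n : ℕ) : Type := Fin n → Qbarˣ

/-- The projective space `ℙⁿ(ℚ̄)`, with homogeneous coordinates indexed by `0, …, n`. -/
abbrev ProjSpace (n : ℕ) : Type := ℙ Qbar (Fin (n + 1) → Qbar)

/-- A subgroup of the torus is algebraic if it is Zariski closed, i.e. if it is the set of common
zeros in the torus of a set of polynomials. (Laurent polynomials define the same closed sets, since
monomials are invertible on the torus.) -/
def IsAlgebraicSubgroup {n : ℕ} (H : Subgroup (Torus n)) : Prop :=
  ∃ S : Set (MvPolynomial (Fin n) Qbar),
    (H : Set (Torus n)) = {γ | ∀ f ∈ S, MvPolynomial.eval (fun i => (γ i : Qbar)) f = 0}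

/-- A sequence in the torus is strict if it eventually avoids any fixed proper
algebraic subgroup. -/
def IsStrict {n : ℕ} (γ : ℕ → Torus n) : Prop :=
  ∀ H : Subgroup (Torus n), IsAlgebraicSubgroup H → H ≠ ⊤ →
    ∃ ℓ₀ : ℕ, ∀ ℓ ≥ ℓ₀, γ ℓ ∉ H

/-- The linear map `(x₀, x₁, …, xₙ) ↦ (x₀, γ₁ x₁, …, γₙ xₙ)`. -/
noncomputable def diagMap {n : ℕ} (γ : Torus n) : (Fin (n + 1) → Qbar) →ₗ[Qbar] (Fin (n + 1) → Qbar) where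
  toFun x i := ((Fin.cons 1 γ : Fin (n + 1) → Qbarˣ) i : Qbar) * x i
  map_add' x y := by
    funext i
    simp [mul_add]
  map_smul' c x := by
    funext i
    simp [mul_left_comm]

theorem diagMap_injective {n : ℕ} (γ : Torus n) : Function.Injective (diagMap γ) := by
  intro x y h
  funext i
  exact (Units.mul_right_inj ((Fin.cons 1 γ : Fin (n + 1) → Qbarˣ) i)).mp (congrFun h i)

/-- The translation `[ξ₀ : ξ₁ : … : ξₙ] ↦ [ξ₀ : γ₁ ξ₁ : … : γₙ ξₙ]` of `ℙⁿ(ℚ̄)` by a point of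
the torus. -/
noncomputable def translation {n : ℕ} (γ : Torus n) : ProjSpace n → ProjSpace n :=
  Projectivization.map (diagMap γ) (diagMap_injective γ)

/-- The zero set in `ℙⁿ(ℚ̄)` of a homogeneous polynomial: the points all of whose vectors of
homogeneous coordinates are zeros of the polynomial. -/
def projZeros {n : ℕ} (f : MvPolynomial (Fin (n + 1)) Qbar) : Set (ProjSpace n) :=
  {p | ∀ (v : Fin (n + 1) → Qbar) (hv : v ≠ 0),
    Projectivization.mk Qbar v hv = p → MvPolynomial.eval v f = 0}

/-- The line `C = Z(x₀ + x₁ + x₂)` in `ℙ²(ℚ̄)`. -/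
noncomputable def lineC : Set (ProjSpace 2) :=
  projZeros (MvPolynomial.X 0 + MvPolynomial.X 1 + MvPolynomial.X 2)

/-- The number field generated by the entries of a vector of algebraic numbers. -/
noncomputable abbrev coordField {n : ℕ} (x : Fin (n + 1) → Qbar) : IntermediateField ℚ Qbar :=
  IntermediateField.adjoin ℚ (Set.range x)

instance coordField_numberField {n : ℕ} (x : Fin (n + 1) → Qbar) :
    NumberField (coordField x) where
  to_charZero := inferInstance
  to_finiteDimensional :=
    IntermediateField.finiteDimensional_adjoin fun y _ => Algebra.IsIntegral.isIntegral y

/-- The absolute logarithmic height of a vector `x` of algebraic numbers, computed in the number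
field `K` generated by its entries. Mathlib's `Height.logHeight` over `K` is the sum over the places
`w` of `K` of `log max |xᵢ|` for the absolute value normalized as `|·|_w ^ [K_w : ℚ_v]`, so that
dividing it by `[K : ℚ]` gives the sum of `([K_w : ℚ_v] / [K : ℚ]) log max |xᵢ|_w`. -/
noncomputable def vectorHeight {n : ℕ} (x : Fin (n + 1) → Qbar) : ℝ :=
  Height.logHeight (fun i =>
    (⟨x i, IntermediateField.subset_adjoin ℚ _ ⟨i, rfl⟩⟩ : coordField x)) /
    (Module.finrank ℚ (coordField x) : ℝ)

/-- The (absolute, logarithmic) Weil height on `ℙⁿ(ℚ̄)`: the height of any vector of homogeneous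
coordinates. -/
noncomputable def weilHeight {n : ℕ} (p : ProjSpace n) : ℝ :=
  vectorHeight p.rep

/-!
With `a = ω₁⁻¹` and `b = ω₂⁻¹`, the lines `C` and `ωC` have the equations `x₀ + x₁ + x₂ = 0` and
`x₀ + a x₁ + b x₂ = 0`, so that they meet in the point `[b - a : 1 - b : a - 1]` alone
(`lineC_inter_translation`). Its archimedean absolute values are the side lengths of the triangles
inscribed in the unit circle with vertices `1`, `σ a`, `σ b`, for the embeddings `σ` of a number
field that contains `a` and `b`. As the sequence is strict, the points `(σ a, σ b)` become
equidistributed on the torus (`tendsto_familyMean`, `norm_mean_embeddings_le`,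
`IsStrict.eventually_ne`), so the limit should be the mean of the logarithm of the longest side of
a random inscribed triangle.

The logarithmic singularity at `a = b = 1` and the finite places are treated together. The finite
places contribute at most `0`, and at least `-∑ log |1 - σ a|` by the product formula. Let `M` be
the longest side, and replace `log u` with `H u = ½ log ((1 - r)² + r u²)` for some `r < 1`, which
is continuous and at least `log u + ½ log r`. Since `log - H` is increasing and `M ≥ |1 - σ a|`,
the height lies between `mean (H M) - mean (H |1 - σ a|)` and `mean (H M) - ½ log r`
(`logHeight_crossVec_div_bounds`). Both means are those of continuous functions, and the second
tends to `0`, because `H |1 - z| = log |1 - r z|` for `|z| = 1` and this has mean `0` by Jensen's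
formula.

The mean of `H M` over the torus reduces to an integral of `log |1 - r e^{2πix}|` over `[0, 1/2]`
against a piecewise linear weight, the length of the set of third vertices for which a given side
is the longest (`integral_max_norm`). Termwise integration of the Fourier series gives a power
series in `r` with coefficients `c_k / k³`, whose value at `r = 1` is `4ζ(3)/π² = 2ζ(3)/(3ζ(2))`
(`tendsto_integral_log_mul_arcWeight`).

The height is defined over the field generated by an arbitrary representative of the point. As
soon as `1`, `a`, `b` are distinct this field contains `a` and `b` (`mem_of_div_mem`), so heights
over different fields need not be compared.
-/

/-! ### A one-dimensional integral with value `4ζ(3)/π²` -/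

open Real in
/-- The real part of the Taylor series of `-log (1 - z)` at `z = r e^{2πix}`. The term
with `k = 0` vanishes, as `x / 0 = 0`. -/
theorem hasSum_log_norm_one_sub_mul_exp {r : ℝ} (h0 : 0 ≤ r) (h1 : r < 1) (x : ℝ) :
    HasSum (fun k : ℕ => -(r ^ k * cos (2 * π * k * x) / k))
      (log ‖1 - r * Complex.exp (2 * π * x * Complex.I)‖) := by
  have hz : ‖(r * Complex.exp (2 * π * x * Complex.I) : ℂ)‖ < 1 := by
    rw [norm_mul, show (2 * π * x * Complex.I : ℂ) = ((2 * π * x : ℝ) : ℂ) * Complex.I by push_cast; ring,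
      Complex.norm_exp_ofReal_mul_I]
    simpa [abs_of_nonneg h0] using h1
  have h := Complex.hasSum_re (Complex.hasSum_taylorSeries_neg_log hz)
  rw [Complex.neg_re, Complex.log_re] at h
  have h' := h.neg
  rw [neg_neg] at h'
  refine Eq.subst (motive := fun f => HasSum f _) (funext fun k => Eq.symm ?_) h'
  rw [mul_pow, ← Complex.exp_nat_mul,
    show ((k : ℂ) * (2 * π * x * Complex.I)) = ((2 * π * k * x : ℝ) : ℂ) * Complex.I by push_cast; ring,
    Complex.exp_mul_I, ← Complex.ofReal_cos, ← Complex.ofReal_sin, ← Complex.ofReal_pow,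
    show ((r ^ k : ℝ) : ℂ) * ((cos (2 * π * k * x) : ℝ) + (sin (2 * π * k * x) : ℝ) * Complex.I) / k =
      ((r ^ k * cos (2 * π * k * x) / k : ℝ) : ℂ) + ((r ^ k * sin (2 * π * k * x) / k : ℝ) : ℂ) * Complex.I by
      push_cast; ring]
  simp only [Complex.add_re, Complex.ofReal_re, Complex.re_ofReal_mul, Complex.I_re, mul_zero, add_zero]

theorem Complex.norm_one_sub_mul_sq {r : ℝ} {z : ℂ} (hz : ‖z‖ = 1) :
    ‖1 - r * z‖ ^ 2 = (1 - r) ^ 2 + r * ‖1 - z‖ ^ 2 := by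
  have h : z.re ^ 2 + z.im ^ 2 = 1 := by
    have := Complex.sq_norm z
    rw [hz, Complex.normSq_apply] at this
    linarith
  rw [Complex.sq_norm, Complex.sq_norm, Complex.normSq_apply, Complex.normSq_apply]
  simp
  linear_combination (r^2 - r) * h

/-- For `0 ≤ x ≤ 1/2`, the length of the set of `t ∈ ℝ/ℤ` that lie within distance `x` of both `0`
and `x` (see `volume_lens_of_abs_le`). -/
noncomputable def arcWeight (x : ℝ) : ℝ := x + max 0 (3 * x - 1)

theorem continuous_arcWeight : Continuous arcWeight := by unfold arcWeight; fun_prop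

open Real intervalIntegral in
theorem integral_affine_mul_cos {c : ℝ} (hc : c ≠ 0) (p q a b : ℝ) :
    ∫ x in a..b, (p * x + q) * cos (c * x) =
      ((p * b + q) * sin (c * b) / c + p * cos (c * b) / c ^ 2) -
      ((p * a + q) * sin (c * a) / c + p * cos (c * a) / c ^ 2) := by
  have := integral_eq_sub_of_hasDerivAt (a := a) (b := b)
    (f := fun x => (p * x + q) * sin (c * x) / c + p * cos (c * x) / c ^ 2)
    (f' := fun x => (p * x + q) * cos (c * x)) (fun x _ => by
      have hl : HasDerivAt (fun x : ℝ => c * x) c x := by simpa using (hasDerivAt_id x).const_mul c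
      have hp : HasDerivAt (fun x : ℝ => p * x + q) p x := by
        simpa using ((hasDerivAt_id x).const_mul p).add_const q
      refine (((hp.mul hl.sin).div_const c).add
        ((hl.cos.const_mul p).div_const (c ^ 2))).congr_deriv ?_
      field_simp
      ring) (Continuous.intervalIntegrable (by fun_prop) _ _)
  exact this

open Real intervalIntegral in
theorem integral_cos_mul_arcWeight {k : ℕ} (hk : k ≠ 0) :
    ∫ x in (0 : ℝ)..(1 / 2), cos (2 * π * k * x) * arcWeight x =
      (4 * (-1) ^ k - 3 * cos (2 * π * k / 3) - 1) / (2 * π * k) ^ 2 := by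
  have hc : 2 * π * k ≠ 0 := by positivity
  have hcont : Continuous fun x => cos (2 * π * k * x) * arcWeight x :=
    (by fun_prop : Continuous fun x : ℝ => cos (2 * π * k * x)).mul continuous_arcWeight
  rw [← integral_add_adjacent_intervals (b := 1 / 3) (hcont.intervalIntegrable _ _)
    (hcont.intervalIntegrable _ _)]
  have e1 : ∫ x in (0 : ℝ)..(1 / 3), cos (2 * π * k * x) * arcWeight x =
      ∫ x in (0 : ℝ)..(1 / 3), (1 * x + 0) * cos (2 * π * k * x) := by
    refine integral_congr fun x hx => ?_
    rw [Set.uIcc_of_le (by norm_num)] at hx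
    simp only [arcWeight]
    rw [max_eq_left (by linarith [hx.2])]
    ring
  have e2 : ∫ x in (1 / 3 : ℝ)..(1 / 2), cos (2 * π * k * x) * arcWeight x =
      ∫ x in (1 / 3 : ℝ)..(1 / 2), (4 * x + (-1)) * cos (2 * π * k * x) := by
    refine integral_congr fun x hx => ?_
    rw [Set.uIcc_of_le (by norm_num)] at hx
    simp only [arcWeight]
    rw [max_eq_right (by linarith [hx.1])]
    ring
  rw [e1, e2, integral_affine_mul_cos hc, integral_affine_mul_cos hc]
  have h1 : 2 * π * k * (1 / 2) = k * π := by ring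
  have h2 : 2 * π * k * (1 / 3) = 2 * π * k / 3 := by ring
  rw [h1, h2, sin_nat_mul_pi, cos_nat_mul_pi]
  simp only [mul_zero, sin_zero, cos_zero]
  field_simp
  ring

open Real in
/-- The number `c_k` such that `-6 ∫₀^{1/2} cos (2πkx) arcWeight x dx = c_k / k²` for `k ≥ 1`. -/
noncomputable def zetaCoeff (k : ℕ) : ℝ :=
  (6 + 18 * cos (2 * π * k / 3) - 24 * (-1) ^ k) / (4 * π ^ 2)

open Real in
theorem abs_zetaCoeff_le (k : ℕ) : |zetaCoeff k| ≤ 48 := by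
  have hpi := pi_gt_three
  have h2 : |(6 + 18 * cos (2 * π * k / 3) - 24 * (-1) ^ k)| ≤ 48 := by
    have := abs_cos_le_one (2 * π * k / 3)
    have h3 : |(-1 : ℝ) ^ k| = 1 := by simp
    rw [abs_le] at this ⊢
    have h4 := abs_le.1 h3.le
    constructor <;> linarith [this.1, this.2, h4.1, h4.2]
  rw [zetaCoeff, abs_div]
  refine (div_le_self (abs_nonneg _) ?_).trans h2
  rw [abs_of_pos (by positivity)]
  nlinarith

open Real intervalIntegral in
/-- Termwise integration of the Fourier series of `log |1 - r e^{2πix}|` against `arcWeight`. -/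
theorem hasSum_integral_log_mul_arcWeight {r : ℝ} (h0 : 0 ≤ r) (h1 : r < 1) :
    HasSum (fun k : ℕ => r ^ k * (zetaCoeff k / k ^ 3))
      (6 * ∫ x in (0 : ℝ)..(1 / 2),
        log ‖1 - r * Complex.exp (2 * π * x * Complex.I)‖ * arcWeight x) := by
  have key : HasSum (fun k : ℕ => ∫ x in (0 : ℝ)..(1 / 2), -(r ^ k * cos (2 * π * k * x) / k) * arcWeight x)
      (∫ x in (0 : ℝ)..(1 / 2), log ‖1 - r * Complex.exp (2 * π * x * Complex.I)‖ * arcWeight x) := by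
    refine hasSum_integral_of_dominated_convergence (fun k _ => r ^ k) (fun k => ?_) (fun k => ?_)
      ?_ ?_ ?_
    · refine Continuous.aestronglyMeasurable ?_
      have := continuous_arcWeight
      fun_prop
    · refine Filter.Eventually.of_forall fun x hx => ?_
      rw [Set.uIoc_of_le (by norm_num)] at hx
      have hw : ‖arcWeight x‖ ≤ 1 := by
        rw [arcWeight, norm_of_nonneg (add_nonneg hx.1.le (le_max_left _ _))]
        have : max 0 (3 * x - 1) ≤ 1 / 2 := max_le (by norm_num) (by linarith [hx.2])
        linarith [hx.2]
      have hc : ‖-(r ^ k * cos (2 * π * k * x) / k)‖ ≤ r ^ k := by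
        rw [norm_neg, norm_div, norm_mul, norm_pow, norm_of_nonneg h0, norm_natCast]
        rcases Nat.eq_zero_or_pos k with rfl | hk
        · simp
        · have : (1 : ℝ) ≤ k := by exact_mod_cast hk
          refine (div_le_self (by positivity) this).trans ?_
          exact mul_le_of_le_one_right (by positivity) (abs_cos_le_one _)
      rw [norm_mul]
      simpa using mul_le_mul hc hw (norm_nonneg _) (by positivity)
    · exact Filter.Eventually.of_forall fun x _ => summable_geometric_of_lt_one h0 h1
    · exact continuous_const.intervalIntegrable _ _
    · exact Filter.Eventually.of_forall fun x _ =>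
        (hasSum_log_norm_one_sub_mul_exp h0 h1 x).mul_right _
  refine Eq.subst (motive := fun f => HasSum f _) (funext fun k => Eq.symm ?_) (key.mul_left 6)
  rcases Nat.eq_zero_or_pos k with rfl | hk
  · simp
  · have hk' : (k : ℝ) ≠ 0 := by positivity
    rw [show (fun x : ℝ => -(r ^ k * cos (2 * π * k * x) / k) * arcWeight x) =
      fun x => (-(r ^ k / k)) * (cos (2 * π * k * x) * arcWeight x) by funext x; ring,
      intervalIntegral.integral_const_mul, integral_cos_mul_arcWeight hk.ne', zetaCoeff]
    field_simp
    ring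

open Real intervalIntegral in
/-- Jensen's formula for `1 - r z`, which has no zero in the closed unit disc. -/
theorem integral_log_norm_one_sub_mul_exp {r : ℝ} (h0 : 0 ≤ r) (h1 : r < 1) :
    ∫ x in (0 : ℝ)..1, log ‖1 - r * Complex.exp (2 * π * x * Complex.I)‖ = 0 := by
  have key : HasSum (fun k : ℕ => ∫ x in (0 : ℝ)..1, -(r ^ k * cos (2 * π * k * x) / k))
      (∫ x in (0 : ℝ)..1, log ‖1 - r * Complex.exp (2 * π * x * Complex.I)‖) := by
    refine hasSum_integral_of_dominated_convergence (fun k _ => r ^ k) (fun k => ?_) (fun k => ?_)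
      ?_ ?_ ?_
    · exact Continuous.aestronglyMeasurable (by fun_prop)
    · refine Filter.Eventually.of_forall fun x hx => ?_
      rw [norm_neg, norm_div, norm_mul, norm_pow, norm_of_nonneg h0, norm_natCast]
      rcases Nat.eq_zero_or_pos k with rfl | hk
      · simp
      · have : (1 : ℝ) ≤ k := by exact_mod_cast hk
        refine (div_le_self (by positivity) this).trans ?_
        exact mul_le_of_le_one_right (by positivity) (abs_cos_le_one _)
    · exact Filter.Eventually.of_forall fun x _ => summable_geometric_of_lt_one h0 h1
    · exact continuous_const.intervalIntegrable _ _
    · exact Filter.Eventually.of_forall fun x _ => hasSum_log_norm_one_sub_mul_exp h0 h1 x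
  refine key.unique ?_
  refine Eq.subst (motive := fun f => HasSum f _) (funext fun k => Eq.symm ?_) hasSum_zero
  rcases Nat.eq_zero_or_pos k with rfl | hk
  · simp
  · have hc : 2 * π * k ≠ 0 := by positivity
    have h := integral_affine_mul_cos hc 0 (-(r ^ k / k)) 0 1
    have hs : sin (2 * π * k) = 0 := by
      rw [show 2 * π * (k : ℝ) = ((2 * k : ℕ) : ℝ) * π by push_cast; ring, sin_nat_mul_pi]
    simp only [mul_one, hs, zero_mul, mul_zero, sin_zero, zero_div, add_zero, sub_zero, zero_add] at h
    refine Eq.trans (integral_congr fun x _ => ?_) h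
    ring

theorem summable_inv_cube : Summable (fun k : ℕ => 1 / (k : ℝ) ^ 3) :=
  Real.summable_one_div_nat_pow.2 (by norm_num)

open Real in
theorem cos_two_pi_mul_div_three (k : ℕ) :
    cos (2 * π * k / 3) = if 3 ∣ k then 1 else -(1 / 2) := by
  have hper : ∀ (m : ℕ) (x : ℝ), cos (2 * π * ((3 * m : ℕ) : ℝ) / 3 + x) = cos x := by
    intro m x
    rw [show 2 * π * ((3 * m : ℕ) : ℝ) / 3 + x = x + m * (2 * π) by push_cast; ring, cos_add_nat_mul_two_pi]
  have h1 : cos (2 * π / 3) = -(1 / 2) := by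
    rw [show 2 * π / 3 = π - π / 3 by ring, cos_pi_sub, cos_pi_div_three]
  have h2 : cos (2 * π * 2 / 3) = -(1 / 2) := by
    rw [show 2 * π * 2 / 3 = π / 3 + π by ring, cos_add_pi, cos_pi_div_three]
  have hk := Nat.div_add_mod k 3
  have hlt := Nat.mod_lt k (show 3 > 0 by norm_num)
  set m := k / 3
  rcases (by omega : k % 3 = 0 ∨ k % 3 = 1 ∨ k % 3 = 2) with h | h | h
  · rw [if_pos (by omega), ← hk, h, add_zero]
    simpa using hper m 0
  · rw [if_neg (by omega), ← hk, h, ← h1, ← hper m (2 * π / 3)]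
    congr 1; push_cast; ring
  · rw [if_neg (by omega), ← hk, h, ← h2, ← hper m (2 * π * 2 / 3)]
    congr 1; push_cast; ring

theorem hasSum_inv_cube_of_dvd {d : ℕ} (hd : d ≠ 0) :
    HasSum (fun k : ℕ => if d ∣ k then 1 / (k : ℝ) ^ 3 else 0)
      ((∑' k : ℕ, 1 / (k : ℝ) ^ 3) / (d : ℝ) ^ 3) := by
  have hinj : Function.Injective fun k : ℕ => d * k := fun a b h =>
    Nat.eq_of_mul_eq_mul_left (Nat.pos_of_ne_zero hd) h
  rw [← hinj.hasSum_iff]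
  · refine Eq.subst (motive := fun f => HasSum f _) (funext fun k => Eq.symm ?_)
      (summable_inv_cube.hasSum.div_const ((d : ℝ) ^ 3))
    rw [Function.comp_apply, if_pos (dvd_mul_right d k)]
    push_cast
    rw [mul_pow, div_div, mul_comm]
  · intro k hk
    rw [if_neg]
    rintro ⟨m, rfl⟩
    exact hk ⟨m, rfl⟩

open Real in
/-- With `cos (2πk/3) = -1/2 + (3/2)·1_{3 ∣ k}` and `(-1)^k = -1 + 2·1_{2 ∣ k}`, the numerator of
`c_k` is `21 + 27·1_{3 ∣ k} - 48·1_{2 ∣ k}`, and `21 + 27/3³ - 48/2³ = 16`. -/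
theorem hasSum_zetaCoeff :
    HasSum (fun k : ℕ => zetaCoeff k / k ^ 3) (4 * (∑' k : ℕ, 1 / (k : ℝ) ^ 3) / π ^ 2) := by
  have h := (((summable_inv_cube.hasSum.mul_left 21).add
    ((hasSum_inv_cube_of_dvd (d := 3) (by norm_num)).mul_left 27)).sub
    ((hasSum_inv_cube_of_dvd (d := 2) (by norm_num)).mul_left 48)).div_const (4 * π ^ 2)
  rw [show 4 * (∑' k : ℕ, 1 / (k : ℝ) ^ 3) / π ^ 2 = (21 * (∑' k : ℕ, 1 / (k : ℝ) ^ 3) +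
    27 * ((∑' k : ℕ, 1 / (k : ℝ) ^ 3) / ((3 : ℕ) : ℝ) ^ 3) -
    48 * ((∑' k : ℕ, 1 / (k : ℝ) ^ 3) / ((2 : ℕ) : ℝ) ^ 3)) / (4 * π ^ 2) by push_cast; ring]
  refine Eq.subst (motive := fun f => HasSum f _) (funext fun k => Eq.symm ?_) h
  have h2 : (-1 : ℝ) ^ k = if 2 ∣ k then 1 else -1 := by
    split_ifs with h
    · exact (even_iff_two_dvd.2 h).neg_one_pow
    · exact (Nat.not_even_iff_odd.1 (fun h' => h h'.two_dvd)).neg_one_pow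
  rw [zetaCoeff, cos_two_pi_mul_div_three, h2]
  split_ifs <;> ring

open Real Filter in
/-- As `r → 1` the series of `hasSum_integral_log_mul_arcWeight` may be evaluated at `r = 1`. -/
theorem tendsto_integral_log_mul_arcWeight :
    Tendsto (fun r : ℝ => 6 * ∫ x in (0 : ℝ)..(1 / 2),
        log ‖1 - r * Complex.exp (2 * π * x * Complex.I)‖ * arcWeight x) (𝓝[<] 1)
      (𝓝 (4 * (∑' k : ℕ, 1 / (k : ℝ) ^ 3) / π ^ 2)) := by
  have hmem : Set.Ioo (0 : ℝ) 1 ∈ 𝓝[<] (1 : ℝ) := Ioo_mem_nhdsLT one_pos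
  have h : Tendsto (fun r : ℝ => ∑' k : ℕ, r ^ k * (zetaCoeff k / k ^ 3)) (𝓝[<] 1)
      (𝓝 (∑' k : ℕ, zetaCoeff k / k ^ 3)) := by
    refine tendsto_tsum_of_dominated_convergence (bound := fun k : ℕ => 48 * (1 / (k : ℝ) ^ 3))
      (summable_inv_cube.mul_left 48) (fun k => ?_) ?_
    · have : Tendsto (fun r : ℝ => r ^ k * (zetaCoeff k / k ^ 3)) (𝓝 1)
          (𝓝 (1 ^ k * (zetaCoeff k / k ^ 3))) :=
        Continuous.tendsto (by fun_prop) 1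
      rw [one_pow, one_mul] at this
      exact this.mono_left nhdsWithin_le_nhds
    · filter_upwards [hmem] with r hr k
      rw [norm_mul, norm_pow, norm_div, norm_pow, norm_natCast, norm_of_nonneg hr.1.le, mul_one_div]
      refine (mul_le_of_le_one_left (by positivity) (pow_le_one₀ hr.1.le hr.2.le)).trans ?_
      gcongr
      exact abs_zetaCoeff_le k
  rw [hasSum_zetaCoeff.tsum_eq] at h
  refine h.congr' ?_
  filter_upwards [hmem] with r hr
  exact (hasSum_integral_log_mul_arcWeight hr.1.le hr.2).tsum_eq

/-! ### The value `2ζ(3)/(3ζ(2)) = 4ζ(3)/π²` and its decimal expansion -/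

/-- The tail is bounded by telescoping, since `1/k³ ≤ 1/((k-1)k(k+1))`. -/
theorem tsum_inv_cube_le (N : ℕ) (hN : 1 ≤ N) :
    ∑' k : ℕ, 1 / (k : ℝ) ^ 3 ≤
      ∑ k ∈ Finset.range (N + 1), 1 / (k : ℝ) ^ 3 + 1 / (2 * (N : ℝ) * (N + 1)) := by
  refine Real.tsum_le_of_sum_range_le (fun k => by positivity) fun n => ?_
  have key : ∀ m, ∑ k ∈ Finset.range (N + 1 + m), 1 / (k : ℝ) ^ 3 ≤
      ∑ k ∈ Finset.range (N + 1), 1 / (k : ℝ) ^ 3 + 1 / (2 * (N : ℝ) * (N + 1)) -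
        1 / (2 * ((N : ℝ) + m) * (N + m + 1)) := by
    intro m
    induction m with
    | zero => simp
    | succ m ih =>
      rw [← add_assoc, Finset.sum_range_succ]
      have hx : (1 : ℝ) ≤ N + m := by
        have : (1 : ℝ) ≤ N := by exact_mod_cast hN
        linarith [(Nat.cast_nonneg m : (0 : ℝ) ≤ m)]
      push_cast
      have e : (1 : ℝ) / (N + 1 + m) ^ 3 ≤
          1 / (2 * ((N : ℝ) + m) * (N + m + 1)) - 1 / (2 * ((N : ℝ) + (m + 1)) * (N + (m + 1) + 1)) := by
        set x : ℝ := N + m with hxdef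
        rw [show (N : ℝ) + 1 + m = x + 1 by rw [hxdef]; ring,
          show (N : ℝ) + (m + 1) = x + 1 by rw [hxdef]; ring,
          show 1 / (2 * x * (x + 1)) - 1 / (2 * (x + 1) * (x + 1 + 1)) = 1 / (x * (x + 1) * (x + 2)) by
            field_simp; ring]
        apply one_div_le_one_div_of_le (by positivity)
        nlinarith
      linarith
  calc ∑ k ∈ Finset.range n, 1 / (k : ℝ) ^ 3 ≤ ∑ k ∈ Finset.range (N + 1 + n), 1 / (k : ℝ) ^ 3 :=
        Finset.sum_le_sum_of_subset_of_nonneg (Finset.range_subset_range.2 (by omega))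
          fun _ _ _ => by positivity
    _ ≤ _ := key n
    _ ≤ _ := by
      have : (0 : ℝ) ≤ 1 / (2 * ((N : ℝ) + n) * (N + n + 1)) := by positivity
      linarith

/-- The tail is bounded by telescoping, since `1/k³ ≥ 4k/(4k⁴+1)` and the right hand side is the
difference of the values of `1/(2x(x+1)+1)` at `k-1` and `k`. -/
theorem le_tsum_inv_cube (N : ℕ) :
    ∑ k ∈ Finset.range (N + 1), 1 / (k : ℝ) ^ 3 + 1 / (2 * (N : ℝ) * (N + 1) + 1) ≤
      ∑' k : ℕ, 1 / (k : ℝ) ^ 3 := by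
  have key : ∀ m, ∑ k ∈ Finset.range (N + 1), 1 / (k : ℝ) ^ 3 + 1 / (2 * (N : ℝ) * (N + 1) + 1) ≤
      ∑ k ∈ Finset.range (m + (N + 1)), 1 / (k : ℝ) ^ 3 +
        1 / (2 * ((N : ℝ) + m) * (N + m + 1) + 1) := by
    intro m
    induction m with
    | zero => simp
    | succ m ih =>
      rw [add_right_comm, Finset.sum_range_succ _ (m + (N + 1))]
      push_cast
      have e : (1 : ℝ) / (2 * ((N : ℝ) + m) * (N + m + 1) + 1) -
          1 / (2 * ((N : ℝ) + (m + 1)) * (N + (m + 1) + 1) + 1) ≤ 1 / ((m : ℝ) + (N + 1)) ^ 3 := by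
        set x : ℝ := N + m with hxdef
        have hx : 0 ≤ x := by positivity
        rw [show (m : ℝ) + (N + 1) = x + 1 by rw [hxdef]; ring,
          show (N : ℝ) + (m + 1) = x + 1 by rw [hxdef]; ring,
          show 1 / (2 * x * (x + 1) + 1) - 1 / (2 * (x + 1) * (x + 1 + 1) + 1) =
            4 * (x + 1) / (4 * (x + 1) ^ 4 + 1) by field_simp; ring,
          div_le_div_iff₀ (by positivity) (by positivity)]
        nlinarith
      linarith
  have hlim : Filter.Tendsto (fun m : ℕ => ∑ k ∈ Finset.range (m + (N + 1)), 1 / (k : ℝ) ^ 3 +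
      1 / (2 * ((N : ℝ) + m) * (N + m + 1) + 1)) Filter.atTop
      (𝓝 (∑' k : ℕ, 1 / (k : ℝ) ^ 3 + 0)) := by
    refine (summable_inv_cube.hasSum.tendsto_sum_nat.comp (Filter.tendsto_add_atTop_nat _)).add ?_
    refine squeeze_zero (fun m => by positivity) (fun m => ?_) tendsto_one_div_add_atTop_nhds_zero_nat
    apply one_div_le_one_div_of_le (by positivity)
    have : (0 : ℝ) ≤ N := by positivity
    have : (0 : ℝ) ≤ m := by positivity
    nlinarith [mul_nonneg (add_nonneg ‹(0 : ℝ) ≤ N› this) (add_nonneg ‹(0 : ℝ) ≤ N› this)]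
  rw [add_zero] at hlim
  exact ge_of_tendsto' hlim key

open Real in
theorem eta_bounds :
    0.487175 ≤ 4 * (∑' k : ℕ, 1 / (k : ℝ) ^ 3) / π ^ 2 ∧
      4 * (∑' k : ℕ, 1 / (k : ℝ) ^ 3) / π ^ 2 < 0.487176 := by
  have h1 := tsum_inv_cube_le 30 (by norm_num)
  have h2 := le_tsum_inv_cube 30
  have l : (1.2020562 : ℝ) ≤ ∑' k : ℕ, 1 / (k : ℝ) ^ 3 :=
    le_trans (by norm_num [Finset.sum_range_succ]) h2
  have u : ∑' k : ℕ, 1 / (k : ℝ) ^ 3 ≤ (1.2020575 : ℝ) :=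
    h1.trans (by norm_num [Finset.sum_range_succ])
  have hpi := pi_gt_d20
  have hpi' := pi_lt_d20
  have hs : 3.14159265 ^ 2 < π ^ 2 := by gcongr; linarith
  have hs' : π ^ 2 < 3.14159266 ^ 2 := by gcongr; linarith
  constructor
  · rw [le_div_iff₀ (by positivity)]
    linarith
  · rw [div_lt_iff₀ (by positivity)]
    linarith

open Complex in
theorem two_mul_riemannZeta_three_div :
    ((4 * (∑' k : ℕ, 1 / (k : ℝ) ^ 3) / Real.pi ^ 2 : ℝ) : ℂ) =
      2 * riemannZeta 3 / (3 * riemannZeta 2) := by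
  have h3 : riemannZeta 3 = ∑' k : ℕ, 1 / (k : ℂ) ^ 3 := by
    exact_mod_cast zeta_nat_eq_tsum_of_gt_one (k := 3) (by norm_num)
  rw [h3, riemannZeta_two]
  push_cast
  have : (Real.pi : ℂ) ≠ 0 := by exact_mod_cast Real.pi_ne_zero
  field_simp
  ring

/-! ### The largest of the distances between three random points of the circle -/

open MeasureTheory

theorem UnitAddCircle.norm_coe_of_abs_le {x : ℝ} (hx : |x| ≤ 1 / 2) : ‖(x : UnitAddCircle)‖ = |x| := by
  rw [AddCircle.norm_coe_eq_abs_iff 1 one_ne_zero]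
  simpa using hx

theorem UnitAddCircle.norm_coe_of_mem_Icc {y : ℝ} (hy : y ∈ Set.Icc (0 : ℝ) 1) :
    ‖(y : UnitAddCircle)‖ = min y (1 - y) := by
  rcases le_total y (1 / 2) with h | h
  · rw [UnitAddCircle.norm_coe_of_abs_le (by rwa [abs_of_nonneg hy.1]), abs_of_nonneg hy.1,
      min_eq_left (by linarith)]
  · have h1 : ((y - 1 : ℝ) : UnitAddCircle) = y := by
      rw [AddCircle.coe_sub, AddCircle.coe_period, sub_zero]
    rw [← h1, UnitAddCircle.norm_coe_of_abs_le (by rw [abs_of_nonpos] <;> linarith [hy.2]),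
      abs_of_nonpos (by linarith [hy.2]), min_eq_right (by linarith)]
    ring

theorem UnitAddCircle.exists_coe_eq_abs_le (t : UnitAddCircle) :
    ∃ x : ℝ, (x : UnitAddCircle) = t ∧ |x| ≤ 1 / 2 := by
  have h := AddCircle.coe_image_Icc_eq (1 : ℝ) (-(1 / 2))
  obtain ⟨x, hx, rfl⟩ := h.ge (Set.mem_univ t)
  exact ⟨x, rfl, abs_le.2 ⟨hx.1, by linarith [hx.2]⟩⟩

theorem UnitAddCircle.volume_sphere (u : UnitAddCircle) (c : ℝ) :
    volume {t : UnitAddCircle | ‖t - u‖ = c} = 0 := by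
  have hpt : ∀ v : UnitAddCircle, volume {v} = 0 := by
    intro v
    have := AddCircle.volume_closedBall (1 : ℝ) (x := v) 0
    simpa using this
  have hsub : {t : UnitAddCircle | ‖t - u‖ = c} ⊆
      {u + (c : UnitAddCircle)} ∪ {u + ((-c : ℝ) : UnitAddCircle)} := by
    intro t ht
    obtain ⟨x, hx, hx'⟩ := UnitAddCircle.exists_coe_eq_abs_le (t - u)
    have h : |x| = c := by
      rw [← UnitAddCircle.norm_coe_of_abs_le hx', hx]; exact ht
    have ht' : t = u + (x : UnitAddCircle) := by rw [hx]; abel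
    rcases abs_choice x with h' | h'
    · left; rw [Set.mem_singleton_iff, ht', ← h, h']
    · right; rw [Set.mem_singleton_iff, ht', ← h, h', neg_neg]
  exact measure_mono_null hsub (measure_union_null (hpt _) (hpt _))

theorem UnitAddCircle.ae_norm_ne :
    ∀ᵐ p : UnitAddCircle × UnitAddCircle, ‖p.1‖ ≠ ‖p.2‖ ∧ ‖p.1‖ ≠ ‖p.2 - p.1‖ ∧ ‖p.2‖ ≠ ‖p.2 - p.1‖ := by
  have h2 : ∀ᵐ p : UnitAddCircle × UnitAddCircle, ‖p.1‖ ≠ ‖p.2 - p.1‖ := by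
    refine Measure.measure_prod_null_of_ae_null ?_ (Filter.Eventually.of_forall fun s => ?_)
    · exact (measurableSet_eq_fun (f := fun p : UnitAddCircle × UnitAddCircle => ‖p.1‖)
        (g := fun p => ‖p.2 - p.1‖) (by fun_prop) (by fun_prop)).compl.compl
    · refine measure_mono_null (fun t ht => ?_) (UnitAddCircle.volume_sphere s ‖s‖)
      simpa [eq_comm] using ht
  have h1 : ∀ᵐ p : UnitAddCircle × UnitAddCircle, ‖p.1‖ ≠ ‖p.2‖ := by
    refine Measure.measure_prod_null_of_ae_null ?_ (Filter.Eventually.of_forall fun s => ?_)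
    · exact (measurableSet_eq_fun (f := fun p : UnitAddCircle × UnitAddCircle => ‖p.1‖)
        (g := fun p => ‖p.2‖) (by fun_prop) (by fun_prop)).compl.compl
    · refine measure_mono_null (fun t ht => ?_) (UnitAddCircle.volume_sphere 0 ‖s‖)
      simpa [eq_comm] using ht
  have h3 : ∀ᵐ p : UnitAddCircle × UnitAddCircle, ‖p.2‖ ≠ ‖p.2 - p.1‖ := by
    have := (Measure.measurePreserving_swap (μ := (volume : Measure UnitAddCircle))
      (ν := (volume : Measure UnitAddCircle))).quasiMeasurePreserving.ae h2
    filter_upwards [this] with p hp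
    simpa [norm_sub_rev] using hp
  filter_upwards [h1, h2, h3] with p a b c using ⟨a, b, c⟩

/-- The points of `ℝ/ℤ` whose distances to `0` and to `s` are at most the distance from `0` to `s`:
the `t` for which `s` is the longest of the sides `s`, `t`, `t - s`. -/
def lens (s : UnitAddCircle) : Set UnitAddCircle :=
  Metric.closedBall 0 ‖s‖ ∩ Metric.closedBall s ‖s‖

theorem mem_lens {s t : UnitAddCircle} : t ∈ lens s ↔ ‖t‖ ≤ ‖s‖ ∧ ‖t - s‖ ≤ ‖s‖ := by
  simp [lens, dist_eq_norm]

theorem measurableSet_lens (s : UnitAddCircle) : MeasurableSet (lens s) :=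
  measurableSet_closedBall.inter measurableSet_closedBall

theorem lens_neg (s : UnitAddCircle) : lens (-s) = Neg.neg ⁻¹' lens s := by
  ext t
  simp only [mem_lens, norm_neg, Set.mem_preimage]
  rw [show -t - s = -(t - -s) by abel, norm_neg]

theorem volume_lens_of_mem_Icc {x : ℝ} (hx : x ∈ Set.Icc (0 : ℝ) (1 / 2)) :
    volume.real (lens (x : UnitAddCircle)) = arcWeight x := by
  obtain ⟨h0, h1⟩ := hx
  have hvol := AddCircle.add_projection_respects_measure (1 : ℝ) 0 (measurableSet_lens (x : UnitAddCircle))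
  have hset : ((QuotientAddGroup.mk ⁻¹' lens (x : UnitAddCircle)) ∩ Set.Ioc (0 : ℝ) (0 + 1) : Set ℝ)
      =ᵐ[volume] (Set.Ioc 0 x ∪ Set.Ioc (1 - x) (2 * x) : Set ℝ) := by
    have hne : ∀ᵐ y : ℝ, y ≠ 1 - x ∧ y ≠ 1 := by
      have a : ∀ᵐ y : ℝ, y ≠ 1 - x := by simp [ae_iff]
      have b : ∀ᵐ y : ℝ, y ≠ 1 := by simp [ae_iff]
      filter_upwards [a, b] with y a b using ⟨a, b⟩
    filter_upwards [hne] with y hy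
    refine propext ?_
    change (((y : UnitAddCircle) ∈ lens x) ∧ y ∈ Set.Ioc (0 : ℝ) (0 + 1)) ↔
      (y ∈ Set.Ioc 0 x ∨ y ∈ Set.Ioc (1 - x) (2 * x))
    have hnx : ‖(x : UnitAddCircle)‖ = x := by
      rw [UnitAddCircle.norm_coe_of_abs_le (by rwa [abs_of_nonneg h0]), abs_of_nonneg h0]
    have key : y ∈ Set.Ioo (0 : ℝ) 1 → ((y : UnitAddCircle) ∈ lens x ↔
        (y ≤ x ∨ 1 - x ≤ y) ∧ y ≤ 2 * x) := by
      intro hy1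
      simp only [mem_lens, hnx, ← AddCircle.coe_sub]
      rw [UnitAddCircle.norm_coe_of_mem_Icc ⟨hy1.1.le, hy1.2.le⟩, min_le_iff]
      refine and_congr ?_ ?_
      · constructor <;> rintro (h | h) <;> first | (left; linarith) | (right; linarith)
      · rcases le_total y x with hyx | hyx
        · rw [UnitAddCircle.norm_coe_of_abs_le (by rw [abs_of_nonpos (by linarith)]; linarith [hy1.1]),
            abs_of_nonpos (by linarith)]
          constructor <;> intro <;> linarith [hy1.1]
        · rw [UnitAddCircle.norm_coe_of_mem_Icc ⟨by linarith, by linarith [hy1.2]⟩, min_le_iff]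
          constructor
          · rintro (h | h) <;> linarith [hy1.2]
          · intro h; left; linarith
    constructor
    · rintro ⟨hl, hy0, hy1⟩
      have hy2 : y < 1 := lt_of_le_of_ne (by linarith) hy.2
      obtain ⟨h | h, h'⟩ := (key ⟨hy0, hy2⟩).1 hl
      · exact Or.inl ⟨hy0, h⟩
      · exact Or.inr ⟨lt_of_le_of_ne h (Ne.symm hy.1), h'⟩
    · rintro (h | h)
      · have hy2 : y < 1 := by linarith [h.2]
        exact ⟨(key ⟨h.1, hy2⟩).2 ⟨Or.inl h.2, by linarith [h.2, h.1]⟩, h.1, by linarith⟩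
      · have hy2 : y < 1 := lt_of_le_of_ne (by linarith [h.2]) hy.2
        have hy0 : 0 < y := by linarith [h.1]
        exact ⟨(key ⟨hy0, hy2⟩).2 ⟨Or.inr h.1.le, h.2⟩, hy0, by linarith⟩
  rw [Measure.real, hvol, measure_congr hset, measure_union (by
    rw [Set.disjoint_left]
    intro y hy hy'
    linarith [hy.2, hy'.1]) measurableSet_Ioc, Real.volume_Ioc, Real.volume_Ioc,
    ENNReal.toReal_add ENNReal.ofReal_ne_top ENNReal.ofReal_ne_top, arcWeight]
  rw [sub_zero, ENNReal.toReal_ofReal h0, ENNReal.toReal_ofReal', max_comm]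
  ring_nf

theorem volume_lens_of_abs_le {x : ℝ} (hx : |x| ≤ 1 / 2) :
    volume.real (lens (x : UnitAddCircle)) = arcWeight |x| := by
  rcases le_total 0 x with h | h
  · rw [abs_of_nonneg h] at hx ⊢
    exact volume_lens_of_mem_Icc ⟨h, hx⟩
  · rw [abs_of_nonpos h] at hx ⊢
    rw [← volume_lens_of_mem_Icc ⟨by linarith, hx⟩, AddCircle.coe_neg, lens_neg, Measure.real,
      Measure.real, Measure.measure_preimage_neg]

theorem integral_mul_volume_lens {φ : ℝ → ℝ} (hφ : Continuous φ) :
    ∫ s : UnitAddCircle, φ ‖s‖ * volume.real (lens s) =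
      2 * ∫ x in (0 : ℝ)..(1 / 2), φ x * arcWeight x := by
  have hc : Continuous fun x : ℝ => φ |x| * arcWeight |x| := by
    have := continuous_arcWeight
    fun_prop
  rw [← UnitAddCircle.intervalIntegral_preimage (-(1 / 2)),
    show ∫ a in (-(1 / 2) : ℝ)..(-(1 / 2) + 1), 
        φ ‖(a : UnitAddCircle)‖ * volume.real (lens (a : UnitAddCircle)) =
      ∫ a in (-(1 / 2) : ℝ)..(-(1 / 2) + 1), φ |a| * arcWeight |a| from
      intervalIntegral.integral_congr fun a ha => by
        rw [Set.uIcc_of_le (by norm_num)] at ha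
        have ha' : |a| ≤ 1 / 2 := abs_le.2 ⟨ha.1, by linarith [ha.2]⟩
        simp only [UnitAddCircle.norm_coe_of_abs_le ha', volume_lens_of_abs_le ha'],
    show (-(1 / 2) + 1 : ℝ) = 1 / 2 by norm_num,
    ← intervalIntegral.integral_add_adjacent_intervals (b := 0) (hc.intervalIntegrable _ _)
      (hc.intervalIntegrable _ _)]
  have e1 := intervalIntegral.integral_comp_neg (a := 0) (b := 1 / 2) (fun x : ℝ => φ |x| * arcWeight |x|)
  have e2 : ∫ x in (0 : ℝ)..(1 / 2), φ |x| * arcWeight |x| = ∫ x in (0 : ℝ)..(1 / 2), φ x * arcWeight x :=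
    intervalIntegral.integral_congr fun a ha => by
      rw [Set.uIcc_of_le (by norm_num)] at ha
      simp only [abs_of_nonneg ha.1]
  simp only [abs_neg, neg_zero] at e1
  rw [← e1, e2, two_mul]

/-- For points `0, s, t` of `ℝ/ℤ`, the mean of a function of the largest mutual distance. Up to the
null set of ties, the torus is cut into three parts according to which of `s`, `t`, `t - s` is
the largest; the measure preserving maps `(s, t) ↦ (t, s)` and `(s, t) ↦ (t - s, t)` carry them
to one another, and on the first part the fibre over `s` is `lens s`. -/
theorem integral_max_norm {φ : ℝ → ℝ} (hφ : Continuous φ) :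
    ∫ p : UnitAddCircle × UnitAddCircle, φ (max (max ‖p.1‖ ‖p.2‖) ‖p.2 - p.1‖) =
      6 * ∫ x in (0 : ℝ)..(1 / 2), φ x * arcWeight x := by
  set E : Set (UnitAddCircle × UnitAddCircle) :=
    {p | ‖p.2‖ ≤ ‖p.1‖} ∩ {p | ‖p.2 - p.1‖ ≤ ‖p.1‖} with hE
  have hEm : MeasurableSet E := 
    (measurableSet_le (by fun_prop) (by fun_prop)).inter (measurableSet_le (by fun_prop) (by fun_prop))
  set Φ : UnitAddCircle × UnitAddCircle → ℝ := E.indicator fun p => φ ‖p.1‖ with hΦ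
  have hint : Integrable Φ :=
    ((by fun_prop : Continuous fun p : UnitAddCircle × UnitAddCircle =>
      φ ‖p.1‖).integrable_of_hasCompactSupport (HasCompactSupport.of_compactSpace _)).indicator hEm
  have hΦI : ∫ p, Φ p = 2 * ∫ x in (0 : ℝ)..(1 / 2), φ x * arcWeight x := by
    rw [← integral_mul_volume_lens hφ, Measure.volume_eq_prod, integral_prod _ hint]
    refine integral_congr_ae (Filter.Eventually.of_forall fun s => ?_)
    have : (fun t => Φ (s, t)) = (lens s).indicator fun _ => φ ‖s‖ := by
      funext t
      have hmem : (s, t) ∈ E ↔ t ∈ lens s := by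
        simp only [hE, Set.mem_inter_iff, Set.mem_ofPred_eq, mem_lens]
      by_cases h : t ∈ lens s
      · rw [Set.indicator_of_mem h, hΦ, Set.indicator_of_mem (hmem.2 h)]
      · rw [Set.indicator_of_notMem h, hΦ, Set.indicator_of_notMem (fun h' => h (hmem.1 h'))]
    simp only [this]
    rw [integral_indicator_const _ (measurableSet_lens s), smul_eq_mul, mul_comm]
  let σ : UnitAddCircle × UnitAddCircle → UnitAddCircle × UnitAddCircle := fun p => (p.2 - p.1, p.2)
  have hσ : Continuous σ := by fun_prop
  have hswap : ∫ p : UnitAddCircle × UnitAddCircle, Φ p.swap = ∫ p, Φ p := integral_prod_swap Φ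
  have hintσ : Integrable (fun p => Φ (σ p)) := by
    have : (fun p => Φ (σ p)) = (σ ⁻¹' E).indicator fun p => φ ‖p.2 - p.1‖ := by
      funext p; rfl
    rw [this]
    exact ((by fun_prop : Continuous fun p : UnitAddCircle × UnitAddCircle =>
      φ ‖p.2 - p.1‖).integrable_of_hasCompactSupport
      (HasCompactSupport.of_compactSpace _)).indicator (hσ.measurable hEm)
  have hσI : ∫ p, Φ (σ p) = ∫ p, Φ p := by
    rw [Measure.volume_eq_prod, integral_prod_symm _ hintσ, integral_prod_symm _ hint]
    refine integral_congr_ae (Filter.Eventually.of_forall fun t => ?_)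
    exact integral_sub_left_eq_self (fun s => Φ (s, t)) volume t
  have hae : (fun p : UnitAddCircle × UnitAddCircle => φ (max (max ‖p.1‖ ‖p.2‖) ‖p.2 - p.1‖)) =ᵐ[volume]
      fun p => Φ p + Φ p.swap + Φ (σ p) := by
    filter_upwards [UnitAddCircle.ae_norm_ne] with p hp
    obtain ⟨h1, h2, h3⟩ := hp
    have e3 : p.2 - (p.2 - p.1) = p.1 := by abel
    simp only [hΦ, Set.indicator_apply, hE, Set.mem_inter_iff, Set.mem_ofPred_eq, Prod.fst_swap,
      Prod.snd_swap, σ, e3, norm_sub_rev p.1 p.2]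
    rcases lt_or_gt_of_ne h1 with h1 | h1 <;> rcases lt_or_gt_of_ne h2 with h2 | h2 <;>
      rcases lt_or_gt_of_ne h3 with h3 | h3 <;>
      first
      | (exfalso; linarith)
      | simp [h1.le, h2.le, h3.le, h1.not_ge, h2.not_ge, h3.not_ge]
  have hintswap : Integrable (fun p : UnitAddCircle × UnitAddCircle => Φ p.swap) := hint.swap
  have hintadd : Integrable (fun p : UnitAddCircle × UnitAddCircle => Φ p + Φ p.swap) := hint.add hintswap
  rw [integral_congr_ae hae, integral_add hintadd hintσ, integral_add hint hintswap, hswap, hσI, hΦI]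
  ring

/-! ### Equidistribution on the torus -/

instance : IsProbabilityMeasure (volume : Measure UnitAddCircle) := ⟨UnitAddCircle.measure_univ⟩

theorem UnitAddCircle.integral_fourier {n : ℤ} (hn : n ≠ 0) :
    ∫ x : UnitAddCircle, fourier n x = 0 :=
  integral_eq_zero_of_add_right_eq_neg (g := ((1 / 2 / n : ℝ) : UnitAddCircle)) fun x => by
    have := fourier_add_half_inv_index hn (one_pos : (0 : ℝ) < 1) x
    convert this using 3

/-- The map `(s, t) ↦ ![s, t]`, by which the Fourier monomials of `UnitAddTorus (Fin 2)` restrict to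
characters of the product of two circles. -/
def torusPair : C(UnitAddCircle × UnitAddCircle, UnitAddTorus (Fin 2)) where
  toFun p := ![p.1, p.2]
  continuous_toFun := by
    refine continuous_pi fun i => ?_
    fin_cases i
    · exact continuous_fst
    · exact continuous_snd

theorem mFourier_torusPair (n : Fin 2 → ℤ) (p : UnitAddCircle × UnitAddCircle) :
    UnitAddTorus.mFourier n (torusPair p) = fourier (n 0) p.1 * fourier (n 1) p.2 := by
  simp [UnitAddTorus.mFourier, torusPair, Fin.prod_univ_two]

/-- The mean value of `F` over a finite family `x` of points, counted with multiplicity. -/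
noncomputable def familyMean {κ X : Type*} [Fintype κ] (x : κ → X) (F : X → ℂ) : ℂ :=
  (∑ i, F (x i)) / Fintype.card κ

theorem norm_familyMean_le {κ X : Type*} [Fintype κ] [Nonempty κ] (x : κ → X) {F : X → ℂ} {C : ℝ}
    (hF : ∀ p, ‖F p‖ ≤ C) : ‖familyMean x F‖ ≤ C := by
  have hc : (0 : ℝ) < Fintype.card κ := by exact_mod_cast Fintype.card_pos
  rw [familyMean, norm_div, Complex.norm_natCast, div_le_iff₀ hc]
  refine (norm_sum_le _ _).trans ((Finset.sum_le_sum fun i _ => hF (x i)).trans ?_)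
  simp [mul_comm]

theorem familyMean_add {κ X : Type*} [Fintype κ] (x : κ → X) (F G : X → ℂ) :
    familyMean x (fun p => F p + G p) = familyMean x F + familyMean x G := by
  simp [familyMean, Finset.sum_add_distrib, add_div]

theorem familyMean_const_mul {κ X : Type*} [Fintype κ] (x : κ → X) (c : ℂ) (F : X → ℂ) :
    familyMean x (fun p => c * F p) = c * familyMean x F := by
  simp [familyMean, ← Finset.mul_sum, mul_div_assoc]

theorem integrable_of_continuous_circle_prod {F : UnitAddCircle × UnitAddCircle → ℂ}
    (hF : Continuous F) : Integrable F :=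
  hF.integrable_of_hasCompactSupport (HasCompactSupport.of_compactSpace _)

open Filter in
/-- Weyl's criterion on the two-dimensional torus: if the means of all nontrivial characters tend to
`0`, then the means of every continuous function tend to its integral. -/
theorem tendsto_familyMean {α : Type*} {l : Filter α} {κ : α → Type*} [∀ a, Fintype (κ a)]
    [∀ a, Nonempty (κ a)] (x : ∀ a, κ a → UnitAddCircle × UnitAddCircle)
    (hx : ∀ m n : ℤ, (m ≠ 0 ∨ n ≠ 0) →
      Tendsto (fun a => familyMean (x a) fun p => fourier m p.1 * fourier n p.2) l (𝓝 0))
    {F : UnitAddCircle × UnitAddCircle → ℂ} (hF : Continuous F) :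
    Tendsto (fun a => familyMean (x a) F) l (𝓝 (∫ p, F p)) := by
  have hspan : ∀ g ∈ Submodule.span ℂ (Set.range (UnitAddTorus.mFourier (d := Fin 2))),
      Tendsto (fun a => familyMean (x a) fun p => g (torusPair p)) l (𝓝 (∫ p, g (torusPair p))) := by
    intro g hg
    induction hg using Submodule.span_induction with
    | mem g hg =>
      obtain ⟨n, rfl⟩ := hg
      simp only [mFourier_torusPair]
      rw [Measure.volume_eq_prod, integral_prod_mul (fun s : UnitAddCircle => (fourier (n 0) s : ℂ))
        (fun t : UnitAddCircle => (fourier (n 1) t : ℂ))]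
      by_cases h : n 0 ≠ 0 ∨ n 1 ≠ 0
      · have h0 : (∫ s : UnitAddCircle, (fourier (n 0) s : ℂ)) *
            ∫ t : UnitAddCircle, (fourier (n 1) t : ℂ) = 0 := by
          rcases h with h | h
          · rw [UnitAddCircle.integral_fourier h, zero_mul]
          · rw [UnitAddCircle.integral_fourier h, mul_zero]
        rw [h0]
        exact hx _ _ h
      · push Not at h
        have : ∀ a, (Fintype.card (κ a) : ℂ) ≠ 0 := fun a => by
          exact_mod_cast Fintype.card_ne_zero
        simpa [h.1, h.2, familyMean, this] using tendsto_const_nhds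
    | zero => simpa [familyMean] using tendsto_const_nhds
    | add f g _ _ hf hg =>
      have hi := fun f : C(UnitAddTorus (Fin 2), ℂ) =>
        integrable_of_continuous_circle_prod (f.continuous.comp torusPair.continuous)
      have e : (∫ p, (f + g) (torusPair p)) = (∫ p, f (torusPair p)) + ∫ p, g (torusPair p) :=
        integral_add (hi f) (hi g)
      rw [e]
      simpa only [ContinuousMap.add_apply, familyMean_add] using hf.add hg
    | smul c f _ hf =>
      have e : (∫ p, (c • f) (torusPair p)) = c * ∫ p, f (torusPair p) :=
        integral_const_mul c _
      rw [e]
      simpa only [ContinuousMap.smul_apply, smul_eq_mul, familyMean_const_mul] using hf.const_mul c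
  let G : C(UnitAddTorus (Fin 2), ℂ) := ⟨fun y => F (y 0, y 1), by fun_prop⟩
  have hG : ∀ p, G (torusPair p) = F p := fun p => rfl
  rw [Metric.tendsto_nhds]
  intro ε hε
  have hmem : G ∈ (Submodule.span ℂ (Set.range (UnitAddTorus.mFourier (d := Fin 2)))).topologicalClosure := by
    rw [UnitAddTorus.span_mFourier_closure_eq_top]
    trivial
  obtain ⟨g, hg, hdist⟩ := Metric.mem_closure_iff.1 hmem (ε / 3) (by positivity)
  have hle : ∀ p, ‖F p - g (torusPair p)‖ ≤ ε / 3 := fun p => by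
    have := (G - g).norm_coe_le_norm (torusPair p)
    rw [dist_eq_norm] at hdist
    exact this.trans hdist.le
  have hgc : Continuous fun p => g (torusPair p) := g.continuous.comp torusPair.continuous
  have h1 : ‖(∫ p, F p) - ∫ p, g (torusPair p)‖ ≤ ε / 3 := by
    rw [← integral_sub (integrable_of_continuous_circle_prod hF) (integrable_of_continuous_circle_prod hgc)]
    refine (norm_integral_le_of_norm_le_const (Eventually.of_forall hle)).trans ?_
    simp
  filter_upwards [Metric.tendsto_nhds.1 (hspan g hg) (ε / 3) (by positivity)] with a ha
  have h2 : ‖familyMean (x a) F - familyMean (x a) fun p => g (torusPair p)‖ ≤ ε / 3 := by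
    have e : familyMean (x a) F = familyMean (x a) (fun p => (F p - g (torusPair p))) +
        familyMean (x a) fun p => g (torusPair p) := by
      rw [← familyMean_add]; simp
    rw [e, add_sub_cancel_right]
    exact norm_familyMean_le _ hle
  rw [dist_eq_norm] at ha ⊢
  calc ‖familyMean (x a) F - ∫ p, F p‖
      = ‖(familyMean (x a) F - familyMean (x a) fun p => g (torusPair p)) +
          ((familyMean (x a) fun p => g (torusPair p)) - ∫ p, g (torusPair p)) -
          ((∫ p, F p) - ∫ p, g (torusPair p))‖ := by congr 1; ring
    _ ≤ _ := (norm_sub_le _ _).trans (add_le_add_left (norm_add_le _ _) _)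
    _ < ε := by linarith

open Filter in
theorem tendsto_real_familyMean {α : Type*} {l : Filter α} {κ : α → Type*} [∀ a, Fintype (κ a)]
    [∀ a, Nonempty (κ a)] (x : ∀ a, κ a → UnitAddCircle × UnitAddCircle)
    (hx : ∀ m n : ℤ, (m ≠ 0 ∨ n ≠ 0) →
      Tendsto (fun a => familyMean (x a) fun p => fourier m p.1 * fourier n p.2) l (𝓝 0))
    {F : UnitAddCircle × UnitAddCircle → ℝ} (hF : Continuous F) :
    Tendsto (fun a => (∑ i, F (x a i)) / Fintype.card (κ a)) l (𝓝 (∫ p, F p)) := by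
  have h := tendsto_familyMean x hx (F := fun p => (F p : ℂ)) (by fun_prop)
  rw [show (∫ p, (F p : ℂ)) = ((∫ p, F p : ℝ) : ℂ) from integral_ofReal] at h
  have h' := (Complex.continuous_re.tendsto _).comp h
  rw [Complex.ofReal_re] at h'
  refine h'.congr fun a => ?_
  simp only [familyMean, Function.comp_apply]
  rw [← Complex.ofReal_sum, ← Complex.ofReal_natCast, ← Complex.ofReal_div, Complex.ofReal_re]

/-! ### Conjugates of a root of unity -/

theorem sum_primitiveRoots_eq_moebius {n : ℕ} (hn : 0 < n) :
    ∑ z ∈ primitiveRoots n ℂ, z = (ArithmeticFunction.moebius n : ℂ) := by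
  have h := (ArithmeticFunction.sum_eq_iff_sum_smul_moebius_eq
    (f := fun n => ∑ z ∈ primitiveRoots n ℂ, z) (g := fun n => if n = 1 then (1 : ℂ) else 0)).1
    (fun n hn => by
      have hz := Complex.isPrimitiveRoot_exp n hn.ne'
      rw [← Finset.sum_biUnion (fun i _ j _ hij => IsPrimitiveRoot.disjoint hij),
        ← IsPrimitiveRoot.nthRoots_one_eq_biUnion_primitiveRoots]
      have : NeZero n := ⟨hn.ne'⟩
      set w := Complex.exp (2 * Real.pi * Complex.I / n)
      have himg : (Polynomial.nthRootsFinset n (1 : ℂ)) = (Finset.range n).image fun i => w ^ i := by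
        ext v
        rw [Polynomial.mem_nthRootsFinset hn, Finset.mem_image]
        constructor
        · intro hv
          obtain ⟨i, hi, hi'⟩ := hz.eq_pow_of_pow_eq_one hv
          exact ⟨i, Finset.mem_range.2 hi, hi'⟩
        · rintro ⟨i, -, rfl⟩
          rw [← pow_mul, mul_comm i n, pow_mul, hz.pow_eq_one, one_pow]
      rw [himg, Finset.sum_image (fun i hi j hj hij => hz.pow_inj (Finset.mem_range.1 hi)
        (Finset.mem_range.1 hj) hij)]
      split_ifs with h1
      · simp [h1]
      · exact hz.geom_sum_eq_zero (by omega)) n hn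
  rw [← h, Finset.sum_eq_single (n, 1)]
  · simp
  · rintro ⟨a, b⟩ hab hne
    rw [if_neg, smul_zero]
    rintro (rfl : b = 1)
    rw [Nat.mem_divisorsAntidiagonal] at hab
    exact hne (by simpa using hab.1)
  · intro h'
    exact absurd (Nat.mem_divisorsAntidiagonal.2 ⟨mul_one n, hn.ne'⟩) h'

open IntermediateField Polynomial in
/-- The conjugates of a root of unity `u` of order `M` in a number field have mean `μ(M)/φ(M)`: the
trace of `u` is a multiple of the sum of the roots of the `M`-th cyclotomic polynomial. -/
theorem norm_mean_embeddings_le {K : Type*} [Field K] [NumberField K] {u : K} (hu : IsOfFinOrder u) :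
    ‖(∑ σ : K →+* ℂ, σ u) / Fintype.card (K →+* ℂ)‖ ≤ 1 / (orderOf u).totient := by
  have hM : 0 < orderOf u := hu.orderOf_pos
  have hprim := IsPrimitiveRoot.orderOf u
  have hmin := cyclotomic_eq_minpoly_rat hprim hM
  have : NeZero ((orderOf u : ℕ) : ℂ) := ⟨by exact_mod_cast hM.ne'⟩
  have hsum : ∑ σ : K →+* ℂ, σ u = algebraMap ℚ ℂ (Algebra.trace ℚ K u) := by
    rw [trace_eq_sum_embeddings ℂ]
    exact Fintype.sum_equiv (RingHom.equivRatAlgHom K ℂ) _ _ fun f => by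
      simp [RingHom.equivRatAlgHom_apply]
  have hroots : ((minpoly ℚ u).aroots ℂ).sum = (ArithmeticFunction.moebius (orderOf u) : ℂ) := by
    rw [← sum_primitiveRoots_eq_moebius hM, aroots, ← hmin, map_cyclotomic,
      cyclotomic.roots_eq_primitiveRoots_val]
    exact congrArg Multiset.sum (Multiset.map_id' _).symm
  have hdeg : Module.finrank ℚ ℚ⟮u⟯ = (orderOf u).totient := by
    rw [adjoin.finrank (Algebra.IsIntegral.isIntegral u), ← hmin, natDegree_cyclotomic]
  have hφ : (0 : ℝ) < (orderOf u).totient := by exact_mod_cast Nat.totient_pos.2 hM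
  have hr : (0 : ℝ) < Module.finrank ℚ⟮u⟯ K := by exact_mod_cast Module.finrank_pos
  rw [hsum, trace_eq_sum_roots (IsAlgClosed.splits _), hroots, NumberField.Embeddings.card,
    ← Module.finrank_mul_finrank ℚ ℚ⟮u⟯ K, hdeg, norm_div, nsmul_eq_mul, norm_mul,
    Complex.norm_natCast, Complex.norm_natCast, Nat.cast_mul, div_le_div_iff₀ (by positivity) hφ]
  have hμ : ‖((ArithmeticFunction.moebius (orderOf u) : ℤ) : ℂ)‖ ≤ 1 := by
    rw [Complex.norm_intCast]
    exact_mod_cast ArithmeticFunction.abs_moebius_le_one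
  nlinarith [mul_le_mul_of_nonneg_left hμ (mul_pos hr hφ).le]

/-- Only finitely many `M` have `φ(M) ≤ B`, in the form of a common multiple: if `p ^ k` divides
`M`, then `p - 1` and `2 ^ (k - 1)` are at most `B`. -/
theorem dvd_factorial_pow_of_totient_le {M B : ℕ} (h0 : M ≠ 0) (h : M.totient ≤ B) :
    M ∣ ((B + 1).factorial) ^ (B + 1) := by
  rw [Nat.dvd_iff_prime_pow_dvd_dvd]
  intro p k hp hk
  rcases Nat.eq_zero_or_pos k with rfl | hk0
  · simp
  have hle : p ^ (k - 1) * (p - 1) ≤ B := by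
    rw [← Nat.totient_prime_pow hp hk0]
    exact (Nat.le_of_dvd (Nat.totient_pos.2 (Nat.pos_of_ne_zero h0)) (Nat.totient_dvd_of_dvd hk)).trans h
  have hp1 : 1 ≤ p - 1 := by have := hp.two_le; omega
  have hpB : p - 1 ≤ B := le_trans (Nat.le_mul_of_pos_left _ (pow_pos hp.pos _)) hle
  have hkB : k - 1 < B := lt_of_lt_of_le (Nat.lt_pow_self hp.one_lt)
    (le_trans (Nat.le_mul_of_pos_right _ hp1) hle)
  exact (pow_dvd_pow p (by omega)).trans
    (pow_dvd_pow_of_dvd ((Nat.Prime.dvd_factorial hp).2 (by omega)) _)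

/-! ### The height over a number field containing both roots of unity -/

/-- For `0 < r < 1`, a continuous approximation of `log u`. The choice is made so that
`smoothLog r |1 - z| = log |1 - r z|` on the unit circle (`smoothLog_norm_one_sub`). -/
noncomputable def smoothLog (r u : ℝ) : ℝ := 1 / 2 * Real.log ((1 - r) ^ 2 + r * u ^ 2)

theorem continuous_smoothLog {r : ℝ} (h0 : 0 < r) (h1 : r < 1) : Continuous (smoothLog r) := by
  unfold smoothLog
  refine continuous_const.mul (Continuous.log (by fun_prop) fun u => ?_)
  have : 0 < 1 - r := by linarith
  positivity

theorem smoothLog_norm_one_sub {r : ℝ} {z : ℂ} (hz : ‖z‖ = 1) :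
    smoothLog r ‖1 - z‖ = Real.log ‖1 - r * z‖ := by
  rw [smoothLog, ← Complex.norm_one_sub_mul_sq hz, Real.log_pow]
  push_cast
  ring

theorem log_le_smoothLog_sub {r u : ℝ} (h0 : 0 < r) (hu : 0 < u) :
    Real.log u ≤ smoothLog r u - 1 / 2 * Real.log r := by
  have h : Real.log (r * u ^ 2) ≤ Real.log ((1 - r) ^ 2 + r * u ^ 2) :=
    Real.log_le_log (by positivity) (by linarith [sq_nonneg (1 - r)])
  rw [Real.log_mul h0.ne' (by positivity), Real.log_pow] at h
  push_cast at h
  rw [smoothLog]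
  linarith

/-- The function `log - smoothLog r` is increasing. -/
theorem smoothLog_sub_le_log_sub {r u M : ℝ} (h0 : 0 < r) (hu : 0 < u) (huM : u ≤ M) :
    smoothLog r M - smoothLog r u ≤ Real.log M - Real.log u := by
  have hM : 0 < M := hu.trans_le huM
  have h : Real.log (u ^ 2 * ((1 - r) ^ 2 + r * M ^ 2)) ≤ Real.log (M ^ 2 * ((1 - r) ^ 2 + r * u ^ 2)) := by
    refine Real.log_le_log (by positivity) ?_
    have : u ^ 2 ≤ M ^ 2 := by gcongr
    nlinarith [mul_le_mul_of_nonneg_right this (sq_nonneg (1 - r))]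
  rw [Real.log_mul (by positivity) (by positivity), Real.log_mul (by positivity) (by positivity),
    Real.log_pow, Real.log_pow] at h
  push_cast at h
  rw [smoothLog, smoothLog]
  linarith

theorem ciSup_fin_three (f : Fin 3 → ℝ) : ⨆ i, f i = max (max (f 2) (f 1)) (f 0) := by
  have hb : BddAbove (Set.range f) := (Set.finite_range f).bddAbove
  refine le_antisymm (ciSup_le fun i => ?_) (max_le (max_le (le_ciSup hb 2) (le_ciSup hb 1)) (le_ciSup hb 0))
  fin_cases i <;> simp

section

variable {K : Type*} [Field K] [NumberField K]

open NumberField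

theorem NumberField.sum_mult_smul_eq_sum_embeddings (f : InfinitePlace K → ℝ) :
    ∑ v : InfinitePlace K, v.mult * f v = ∑ σ : K →+* ℂ, f (InfinitePlace.mk σ) := by
  classical
  rw [← Finset.univ.sum_fiberwise (fun σ : K →+* ℂ => InfinitePlace.mk σ)]
  refine Finset.sum_congr rfl fun v _ => ?_
  rw [← InfinitePlace.card_filter_mk_eq, ← nsmul_eq_mul, ← Finset.sum_const]
  exact Finset.sum_congr rfl fun σ hσ => by rw [(Finset.mem_filter.1 hσ).2]

theorem NumberField.FinitePlace.eq_one_of_isOfFinOrder (v : FinitePlace K) {a : K} (ha : IsOfFinOrder a) :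
    v a = 1 := by
  obtain ⟨n, hn, h⟩ := isOfFinOrder_iff_pow_eq_one.1 ha
  refine (pow_eq_one_iff_of_nonneg (apply_nonneg v a) hn.ne').1 ?_
  rw [← map_pow, h, map_one]

theorem NumberField.FinitePlace.sub_le_one (v : FinitePlace K) {a b : K} (ha : IsOfFinOrder a)
    (hb : IsOfFinOrder b) : v (a - b) ≤ 1 := by
  rw [sub_eq_add_neg]
  refine (FinitePlace.add_le v a (-b)).trans ?_
  have : v (-b) = v b := by
    rw [FinitePlace.coe_apply]
    exact AbsoluteValue.map_neg _ _
  rw [this, v.eq_one_of_isOfFinOrder ha, v.eq_one_of_isOfFinOrder hb, max_self]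

/-- The cross product of `(1, 1, 1)` and `(1, a, b)`. -/
def crossVec {R : Type*} [Ring R] (a b : R) : Fin 3 → R := ![b - a, 1 - b, a - 1]

/-- The length of the longest side of the triangle with vertices `1`, `a`, `b`. -/
noncomputable def maxSide (a b : ℂ) : ℝ := max (max ‖1 - a‖ ‖1 - b‖) ‖b - a‖

/-- The entries of `crossVec a b` are differences of roots of unity, hence of absolute value at most
`1` at the finite places. So the finite places contribute at most `0` to the height, and by the
product formula for `a - 1` at least `-∑ log |1 - σ a|`. -/
theorem logHeight_crossVec_bounds {a b : K} (ha : IsOfFinOrder a) (hb : IsOfFinOrder b) (ha1 : a ≠ 1) :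
    ∑ σ : K →+* ℂ, (Real.log (maxSide (σ a) (σ b)) - Real.log ‖1 - σ a‖) ≤
        Height.logHeight (crossVec a b) ∧
      Height.logHeight (crossVec a b) ≤ ∑ σ : K →+* ℂ, Real.log (maxSide (σ a) (σ b)) := by
  have hone : IsOfFinOrder (1 : K) := IsOfFinOrder.one
  have ha0 : a - 1 ≠ 0 := sub_ne_zero.2 ha1
  have hne : crossVec a b ≠ 0 := fun h => ha0 (congrFun h 2)
  have hle (v : FinitePlace K) : ⨆ i, v (crossVec a b i) ≤ 1 := by
    rw [ciSup_fin_three]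
    exact max_le (max_le (v.sub_le_one ha hone) (v.sub_le_one hone hb)) (v.sub_le_one hb ha)
  have hge (v : FinitePlace K) : v (a - 1) ≤ ⨆ i, v (crossVec a b i) := by
    rw [ciSup_fin_three]
    exact (le_max_left _ _).trans (le_max_left _ _)
  have hpos (v : FinitePlace K) : 0 < v (a - 1) := by
    rw [FinitePlace.coe_apply]
    exact AbsoluteValue.pos _ ha0
  have hfin : (Function.mulSupport fun v : FinitePlace K => v (a - 1)).Finite :=
    FinitePlace.hasFiniteMulSupport ha0
  have hsub : (Function.mulSupport fun v : FinitePlace K => ⨆ i, v (crossVec a b i)) ⊆ hfin.toFinset := by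
    intro v hv
    rw [Set.Finite.coe_toFinset]
    intro h
    exact hv (le_antisymm (hle v) (h ▸ hge v))
  set F := ∏ᶠ v : FinitePlace K, ⨆ i, v (crossVec a b i)
  have hF : F = ∏ v ∈ hfin.toFinset, ⨆ i, v (crossVec a b i) := finprod_eq_prod_of_mulSupport_subset _ hsub
  have hF1 : F ≤ 1 := by
    rw [hF]
    exact Finset.prod_le_one (fun v _ => (hpos v).le.trans (hge v)) fun v _ => hle v
  have hG : ∏ᶠ v : FinitePlace K, v (a - 1) ≤ F := by
    rw [hF, finprod_eq_prod_of_mulSupport_subset (s := hfin.toFinset) _ (by simp)]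
    exact Finset.prod_le_prod (fun v _ => (hpos v).le) fun v _ => hge v
  have hG0 : 0 < ∏ᶠ v : FinitePlace K, v (a - 1) := by
    rw [finprod_eq_prod_of_mulSupport_subset (s := hfin.toFinset) _ (by simp)]
    exact Finset.prod_pos fun v _ => hpos v
  have hF0 : 0 < F := hG0.trans_le hG
  have harch (v : InfinitePlace K) : 0 < v (a - 1) := InfinitePlace.pos_iff.2 ha0
  have hprod := NumberField.prod_abs_eq_one ha0
  have hlog : Real.log (∏ᶠ v : FinitePlace K, v (a - 1)) = -∑ σ : K →+* ℂ, Real.log ‖1 - σ a‖ := by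
    have h := congrArg Real.log hprod
    rw [Real.log_mul (Finset.prod_ne_zero_iff.2 fun v _ => (pow_pos (harch v) _).ne') hG0.ne', Real.log_one,
      Real.log_prod fun v _ => (pow_pos (harch v) _).ne'] at h
    simp only [Real.log_pow] at h
    rw [NumberField.sum_mult_smul_eq_sum_embeddings fun v => Real.log (v (a - 1))] at h
    have e : ∀ σ : K →+* ℂ, InfinitePlace.mk σ (a - 1) = ‖1 - σ a‖ := fun σ => by
      rw [InfinitePlace.apply, map_sub, map_one, norm_sub_rev]
    simp only [e] at h
    linarith
  have hsup (σ : K →+* ℂ) : ⨆ i, InfinitePlace.mk σ (crossVec a b i) = maxSide (σ a) (σ b) := by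
    rw [ciSup_fin_three]
    simp [crossVec, maxSide, InfinitePlace.apply, norm_sub_rev (σ a) 1]
  have hsupos (v : InfinitePlace K) : 0 < ⨆ i, v (crossVec a b i) := by
    rw [ciSup_fin_three]
    exact (harch v).trans_le ((le_max_left _ _).trans (le_max_left _ _))
  have hh : Height.logHeight (crossVec a b) = ∑ σ : K →+* ℂ, Real.log (maxSide (σ a) (σ b)) + Real.log F := by
    rw [Height.logHeight_eq_log_mulHeight, NumberField.mulHeight_eq hne,
      Real.log_mul (Finset.prod_ne_zero_iff.2 fun v _ => (pow_pos (hsupos v) _).ne') hF0.ne',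
      Real.log_prod fun v _ => (pow_pos (hsupos v) _).ne']
    simp only [Real.log_pow]
    rw [NumberField.sum_mult_smul_eq_sum_embeddings fun v => Real.log (⨆ i, v (crossVec a b i))]
    simp only [hsup]
  constructor
  · rw [hh, Finset.sum_sub_distrib]
    have := Real.log_le_log hG0 hG
    linarith
  · rw [hh]
    linarith [Real.log_nonpos hF0.le hF1]

/-- The logarithmic singularities cancel in the lower bound: both `log (maxSide (σ a) (σ b))` and
`log |1 - σ a|` get replaced with their continuous approximations. -/
theorem logHeight_crossVec_div_bounds {a b : K} (ha : IsOfFinOrder a) (hb : IsOfFinOrder b) (ha1 : a ≠ 1)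
    {r : ℝ} (hr : 0 < r) :
    (∑ σ : K →+* ℂ, smoothLog r (maxSide (σ a) (σ b))) / Fintype.card (K →+* ℂ) -
        (∑ σ : K →+* ℂ, smoothLog r ‖1 - σ a‖) / Fintype.card (K →+* ℂ) ≤
        Height.logHeight (crossVec a b) / (Module.finrank ℚ K : ℝ) ∧
      Height.logHeight (crossVec a b) / (Module.finrank ℚ K : ℝ) ≤
        (∑ σ : K →+* ℂ, smoothLog r (maxSide (σ a) (σ b))) / Fintype.card (K →+* ℂ) -
          1 / 2 * Real.log r := by
  obtain ⟨h1, h2⟩ := logHeight_crossVec_bounds ha hb ha1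
  have hd : (0 : ℝ) < Fintype.card (K →+* ℂ) := by exact_mod_cast Fintype.card_pos
  have hpos (σ : K →+* ℂ) : 0 < ‖1 - σ a‖ := by
    rw [norm_pos_iff, sub_ne_zero, ← map_one σ]
    exact fun h => ha1 (σ.injective h).symm
  have hle (σ : K →+* ℂ) : ‖1 - σ a‖ ≤ maxSide (σ a) (σ b) := (le_max_left _ _).trans (le_max_left _ _)
  rw [← NumberField.Embeddings.card K ℂ, ← sub_div, ← Finset.sum_sub_distrib]
  constructor
  · gcongr
    exact (Finset.sum_le_sum fun σ _ => smoothLog_sub_le_log_sub hr (hpos σ) (hle σ)).trans h1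
  · rw [div_le_iff₀ hd, sub_mul, div_mul_cancel₀ _ hd.ne']
    refine h2.trans ((Finset.sum_le_sum fun σ _ =>
      log_le_smoothLog_sub hr ((hpos σ).trans_le (hle σ))).trans ?_)
    simp [Finset.sum_sub_distrib]
    linarith

end

/-! ### The limit of the heights -/

theorem norm_one_sub_toCircle (s : UnitAddCircle) :
    ‖1 - (AddCircle.toCircle s : ℂ)‖ = 2 * Real.sin (Real.pi * ‖s‖) := by
  obtain ⟨x, rfl, hx⟩ := UnitAddCircle.exists_coe_eq_abs_le s
  rw [UnitAddCircle.norm_coe_of_abs_le hx, AddCircle.toCircle_apply_mk, norm_sub_rev, Circle.coe_exp,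
    mul_comm _ Complex.I, Complex.norm_exp_I_mul_ofReal_sub_one, div_one,
    show 2 * Real.pi * x / 2 = Real.pi * x by ring, norm_mul, Real.norm_eq_abs, Real.norm_eq_abs,
    abs_two]
  have hpi := Real.pi_pos
  have h0 : 0 ≤ Real.sin (Real.pi * |x|) :=
    Real.sin_nonneg_of_nonneg_of_le_pi (by positivity) (by nlinarith)
  rcases abs_choice x with h | h
  · rw [h] at h0 ⊢
    rw [abs_of_nonneg h0]
  · rw [h, mul_neg, Real.sin_neg] at h0 ⊢
    rw [abs_of_nonpos (by linarith)]

theorem norm_toCircle_sub_toCircle (s t : UnitAddCircle) :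
    ‖(AddCircle.toCircle t : ℂ) - AddCircle.toCircle s‖ = 2 * Real.sin (Real.pi * ‖t - s‖) := by
  rw [← norm_one_sub_toCircle, norm_sub_rev]
  have h : (AddCircle.toCircle t : ℂ) = AddCircle.toCircle (t - s) * AddCircle.toCircle s := by
    rw [← Circle.coe_mul, ← AddCircle.toCircle_add, sub_add_cancel]
  rw [norm_sub_rev, h, ← sub_one_mul, norm_mul, Circle.norm_coe, mul_one, norm_sub_rev]

/-- Chord length is an increasing function of the distance in `ℝ/ℤ`, so the longest chord comes from
the largest distance. -/
theorem maxSide_toCircle (s t : UnitAddCircle) :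
    maxSide (AddCircle.toCircle s) (AddCircle.toCircle t) =
      2 * Real.sin (Real.pi * max (max ‖s‖ ‖t‖) ‖t - s‖) := by
  have hmono : MonotoneOn (fun x : ℝ => 2 * Real.sin (Real.pi * x)) (Set.Icc 0 (1 / 2)) := by
    intro x hx y hy hxy
    have hpi := Real.pi_pos
    have := Real.sin_le_sin_of_le_of_le_pi_div_two (x := Real.pi * x) (y := Real.pi * y)
      (by nlinarith [hx.1]) (by nlinarith [hy.2]) (by gcongr)
    simp only
    linarith
  have hmem : ∀ u : UnitAddCircle, ‖u‖ ∈ Set.Icc (0 : ℝ) (1 / 2) := fun u =>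
    ⟨norm_nonneg _, by simpa using AddCircle.norm_le_half_period (1 : ℝ) (x := u) one_ne_zero⟩
  have hmax : max ‖s‖ ‖t‖ ∈ Set.Icc (0 : ℝ) (1 / 2) := by
    rcases max_choice ‖s‖ ‖t‖ with h | h <;> rw [h] <;> exact hmem _
  rw [maxSide, norm_one_sub_toCircle, norm_one_sub_toCircle, norm_toCircle_sub_toCircle]
  have e1 := hmono.map_max hmax (hmem (t - s))
  have e2 := hmono.map_max (hmem s) (hmem t)
  rw [e1, e2]

theorem norm_one_sub_exp {x : ℝ} (hx : x ∈ Set.Icc (0 : ℝ) 1) :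
    ‖1 - Complex.exp (2 * Real.pi * x * Complex.I)‖ = 2 * Real.sin (Real.pi * x) := by
  have h0 : 0 ≤ Real.sin (Real.pi * x) :=
    Real.sin_nonneg_of_nonneg_of_le_pi (mul_nonneg Real.pi_pos.le hx.1)
      (mul_le_of_le_one_right Real.pi_pos.le hx.2)
  rw [norm_sub_rev, show (2 * Real.pi * x * Complex.I : ℂ) = Complex.I * ((2 * Real.pi * x : ℝ) : ℂ) by
    push_cast; ring, Complex.norm_exp_I_mul_ofReal_sub_one,
    show 2 * Real.pi * x / 2 = Real.pi * x by ring, norm_mul, Real.norm_of_nonneg h0, Real.norm_eq_abs, abs_two]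

theorem norm_exp_two_pi_mul_I (x : ℝ) : ‖Complex.exp (2 * Real.pi * x * Complex.I)‖ = 1 := by
  rw [show (2 * Real.pi * x * Complex.I : ℂ) = ((2 * Real.pi * x : ℝ) : ℂ) * Complex.I by push_cast; ring,
    Complex.norm_exp_ofReal_mul_I]

theorem integral_smoothLog_maxSide {r : ℝ} (h0 : 0 < r) (h1 : r < 1) :
    ∫ p : UnitAddCircle × UnitAddCircle,
        smoothLog r (maxSide (AddCircle.toCircle p.1) (AddCircle.toCircle p.2)) =
      6 * ∫ x in (0 : ℝ)..(1 / 2),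
        Real.log ‖1 - r * Complex.exp (2 * Real.pi * x * Complex.I)‖ * arcWeight x := by
  have hc : Continuous fun y : ℝ => smoothLog r (2 * Real.sin (Real.pi * y)) :=
    (continuous_smoothLog h0 h1).comp (by fun_prop)
  simp only [maxSide_toCircle]
  rw [integral_max_norm hc]
  congr 1
  refine intervalIntegral.integral_congr fun x hx => ?_
  rw [Set.uIcc_of_le (by norm_num)] at hx
  rw [← smoothLog_norm_one_sub (norm_exp_two_pi_mul_I x), norm_one_sub_exp ⟨hx.1, by linarith [hx.2]⟩]

theorem integral_smoothLog_norm_one_sub {r : ℝ} (h0 : 0 < r) (h1 : r < 1) :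
    ∫ p : UnitAddCircle × UnitAddCircle, smoothLog r ‖1 - (AddCircle.toCircle p.1 : ℂ)‖ = 0 := by
  have e : ∫ p : UnitAddCircle × UnitAddCircle, smoothLog r ‖1 - (AddCircle.toCircle p.1 : ℂ)‖ =
      ∫ s : UnitAddCircle, smoothLog r ‖1 - (AddCircle.toCircle s : ℂ)‖ := by
    rw [Measure.volume_eq_prod]
    simpa using integral_fun_fst (μ := (volume : Measure UnitAddCircle)) (ν := (volume : Measure UnitAddCircle))
      (fun s : UnitAddCircle => smoothLog r ‖1 - (AddCircle.toCircle s : ℂ)‖)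
  rw [e, ← UnitAddCircle.intervalIntegral_preimage 0, zero_add]
  refine Eq.trans (intervalIntegral.integral_congr fun x _ => ?_) (integral_log_norm_one_sub_mul_exp h0.le h1)
  rw [smoothLog_norm_one_sub (Circle.norm_coe _), AddCircle.toCircle_apply_mk, Circle.coe_exp, div_one]
  push_cast
  rfl

theorem continuous_maxSide_toCircle :
    Continuous fun p : UnitAddCircle × UnitAddCircle =>
      maxSide (AddCircle.toCircle p.1) (AddCircle.toCircle p.2) := by
  simp only [maxSide_toCircle]
  fun_prop

theorem exists_toCircle_eq {z : ℂ} (hz : ‖z‖ = 1) :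
    ∃ s : UnitAddCircle, (AddCircle.toCircle s : ℂ) = z := by
  obtain ⟨s, hs⟩ := (AddCircle.homeomorphCircle (one_ne_zero : (1 : ℝ) ≠ 0)).surjective
    ⟨z, mem_sphere_zero_iff_norm.2 hz⟩
  refine ⟨s, ?_⟩
  rw [AddCircle.homeomorphCircle_apply] at hs
  rw [hs]

theorem norm_embedding_eq_one {K : Type*} [Field K] {a : K} (ha : IsOfFinOrder a) (σ : K →+* ℂ) :
    ‖σ a‖ = 1 :=
  (σ.toMonoidHom.isOfFinOrder ha).norm_eq_one

open Filter in
theorem tendsto_mean_embeddings {α : Type*} {l : Filter α} {K : α → Type*} [∀ i, Field (K i)]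
    [∀ i, NumberField (K i)] {u : ∀ i, K i} (hu : ∀ i, IsOfFinOrder (u i))
    (h : ∀ N : ℕ, 0 < N → ∀ᶠ i in l, u i ^ N ≠ 1) :
    Tendsto (fun i => (∑ σ : K i →+* ℂ, σ (u i)) / (Fintype.card (K i →+* ℂ) : ℂ)) l (𝓝 0) := by
  rw [Metric.tendsto_nhds]
  intro ε hε
  obtain ⟨B, hB⟩ := exists_nat_one_div_lt hε
  filter_upwards [h (((B + 1).factorial) ^ (B + 1)) (by positivity)] with i hi
  have hB' : B + 1 ≤ (orderOf (u i)).totient := by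
    by_contra hlt
    exact hi (orderOf_dvd_iff_pow_eq_one.1
      (dvd_factorial_pow_of_totient_le (hu i).orderOf_pos.ne' (by omega)))
  rw [dist_zero_right]
  refine (norm_mean_embeddings_le (hu i)).trans_lt (lt_of_le_of_lt ?_ hB)
  apply one_div_le_one_div_of_le (by positivity)
  exact_mod_cast hB'

open Filter in
/-- The heights of `crossVec a b` tend to `4ζ(3)/π²` along every family of pairs of roots of unity
that escapes every nontrivial multiplicative relation. -/
theorem tendsto_logHeight_crossVec {α : Type*} {l : Filter α} {K : α → Type*} [∀ i, Field (K i)]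
    [∀ i, NumberField (K i)] {a b : ∀ i, K i} (ha : ∀ i, IsOfFinOrder (a i))
    (hb : ∀ i, IsOfFinOrder (b i))
    (h : ∀ m n : ℤ, (m ≠ 0 ∨ n ≠ 0) → ∀ᶠ i in l, a i ^ m * b i ^ n ≠ 1) :
    Tendsto (fun i => Height.logHeight (crossVec (a i) (b i)) / (Module.finrank ℚ (K i) : ℝ)) l
      (𝓝 (4 * (∑' k : ℕ, 1 / (k : ℝ) ^ 3) / Real.pi ^ 2)) := by
  choose s hs using fun i (σ : K i →+* ℂ) => exists_toCircle_eq (norm_embedding_eq_one (ha i) σ)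
  choose t ht using fun i (σ : K i →+* ℂ) => exists_toCircle_eq (norm_embedding_eq_one (hb i) σ)
  let x : ∀ i, (K i →+* ℂ) → UnitAddCircle × UnitAddCircle := fun i σ => (s i σ, t i σ)
  have hx1 : ∀ i σ, (AddCircle.toCircle (x i σ).1 : ℂ) = σ (a i) := hs
  have hx2 : ∀ i σ, (AddCircle.toCircle (x i σ).2 : ℂ) = σ (b i) := ht
  have hchar : ∀ m n : ℤ, (m ≠ 0 ∨ n ≠ 0) →
      Tendsto (fun i => familyMean (x i) fun p => fourier m p.1 * fourier n p.2) l (𝓝 0) := by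
    intro m n hmn
    refine (tendsto_mean_embeddings (u := fun i => a i ^ m * b i ^ n) (fun i => ?_) fun N hN => ?_).congr
      fun i => ?_
    · have hz : ∀ {c : K i} (k : ℤ), IsOfFinOrder c → IsOfFinOrder (c ^ k) := by
        intro c k hc
        obtain ⟨N, hN, hcN⟩ := isOfFinOrder_iff_pow_eq_one.1 hc
        refine isOfFinOrder_iff_pow_eq_one.2 ⟨N, hN, ?_⟩
        rw [← zpow_natCast, zpow_comm, zpow_natCast, hcN, one_zpow]
      exact (hz m (ha i)).mul (hz n (hb i))
    -- `(a ^ m * b ^ n) ^ N = 1` is again a multiplicative relation between `a` and `b`.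
    · have hN' : (N : ℤ) ≠ 0 := by exact_mod_cast hN.ne'
      filter_upwards [h (m * N) (n * N) (hmn.imp (mul_ne_zero · hN') (mul_ne_zero · hN'))] with i hi
      rwa [mul_pow, ← zpow_natCast, ← zpow_natCast, ← zpow_mul, ← zpow_mul]
    · rw [familyMean]
      congr 1
      refine Finset.sum_congr rfl fun σ _ => ?_
      rw [fourier_apply, fourier_apply, AddCircle.toCircle_zsmul, AddCircle.toCircle_zsmul, Circle.coe_zpow,
        Circle.coe_zpow, hx1, hx2, map_mul, map_zpow₀, map_zpow₀]
  have hone : ∀ᶠ i in l, a i ≠ 1 := by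
    filter_upwards [h 1 0 (Or.inl one_ne_zero)] with i hi
    simpa using hi
  rw [Metric.tendsto_nhds]
  intro ε hε
  have hlog : Tendsto (fun r : ℝ => -(1 / 2 * Real.log r)) (𝓝[<] 1) (𝓝 0) := by
    have : Tendsto (fun r : ℝ => -(1 / 2 * Real.log r)) (𝓝 1) (𝓝 (-(1 / 2 * Real.log 1))) :=
      ((Real.continuousAt_log one_ne_zero).tendsto.const_mul _).neg
    rw [Real.log_one, mul_zero, neg_zero] at this
    exact this.mono_left nhdsWithin_le_nhds
  have hIoo : ∀ᶠ r in 𝓝[<] (1 : ℝ), r ∈ Set.Ioo (0 : ℝ) 1 := Ioo_mem_nhdsLT one_pos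
  -- `r` is fixed first, so close to `1` that both bounds of `logHeight_crossVec_div_bounds` have
  -- limits within `2ε/3` of the expected value; only then does equidistribution enter.
  obtain ⟨r, ⟨hr0, hr1⟩, hrI, hrl⟩ := (hIoo.and ((Metric.tendsto_nhds.1
    tendsto_integral_log_mul_arcWeight (ε / 3) (by positivity)).and (Metric.tendsto_nhds.1 hlog (ε / 3) (by positivity)))).exists
  rw [← integral_smoothLog_maxSide hr0 hr1] at hrI
  have hA := tendsto_real_familyMean x hchar
    (F := fun p => smoothLog r (maxSide (AddCircle.toCircle p.1) (AddCircle.toCircle p.2)))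
    ((continuous_smoothLog hr0 hr1).comp continuous_maxSide_toCircle)
  have hB := tendsto_real_familyMean x hchar
    (F := fun p => smoothLog r ‖1 - (AddCircle.toCircle p.1 : ℂ)‖)
    ((continuous_smoothLog hr0 hr1).comp (by simp only [norm_one_sub_toCircle]; fun_prop))
  rw [integral_smoothLog_norm_one_sub hr0 hr1] at hB
  simp only [hx1, hx2] at hA hB
  filter_upwards [hone, Metric.tendsto_nhds.1 hA (ε / 3) (by positivity),
    Metric.tendsto_nhds.1 hB (ε / 3) (by positivity)] with i h1 hAi hBi
  obtain ⟨hlo, hup⟩ := logHeight_crossVec_div_bounds (ha i) (hb i) h1 hr0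
  rw [Real.dist_eq, abs_lt] at hrI hrl hAi hBi ⊢
  constructor <;> linarith [hrI.1, hrI.2, hrl.1, hrl.2, hAi.1, hAi.2, hBi.1, hBi.2]

/-! ### Recovering the roots of unity from the homogeneous coordinates -/

/-- A triangle inscribed in the unit circle with a vertex at `1` is determined by its shape
`(B - 1) / (A - 1)`: complex conjugation multiplies this ratio by `A / B`, so that `A / B` is determined
as well. -/
theorem eq_of_div_eq_of_norm_eq_one {A B A' B' : ℂ} (hA : ‖A‖ = 1) (hB : ‖B‖ = 1) (hA' : ‖A'‖ = 1)
    (hB' : ‖B'‖ = 1) (hA1 : A ≠ 1) (hB1 : B ≠ 1) (hA1' : A' ≠ 1) (hAB : A ≠ B)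
    (h : (B - 1) * (A' - 1) = (B' - 1) * (A - 1)) : A' = A ∧ B' = B := by
  have hne : ∀ {z : ℂ}, ‖z‖ = 1 → z ≠ 0 := fun hz h0 => by simp [h0] at hz
  have hconj := congrArg (starRingEnd ℂ) h
  simp only [map_mul, map_sub, map_one, ← Complex.inv_eq_conj hA, ← Complex.inv_eq_conj hB,
    ← Complex.inv_eq_conj hA', ← Complex.inv_eq_conj hB'] at hconj
  have hA0 := hne hA
  have hB0 := hne hB
  have hA0' := hne hA'
  have hB0' := hne hB'
  field_simp at hconj
  have h1 : (B - 1) * (A' - 1) ≠ 0 := mul_ne_zero (sub_ne_zero.2 hB1) (sub_ne_zero.2 hA1')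
  have h2 : B' * A = B * A' := by
    apply mul_left_cancel₀ h1
    linear_combination hconj - B * A' * h
  have h3 : (A - A') * (B - A) = 0 := by
    linear_combination -A * h + (1 - A) * h2
  have h4 : A' = A := by
    rcases mul_eq_zero.1 h3 with h | h
    · exact (sub_eq_zero.1 h).symm
    · exact absurd (sub_eq_zero.1 h).symm hAB
  refine ⟨h4, ?_⟩
  subst h4
  exact mul_right_cancel₀ hA0 h2

/-- A field that contains the ratio of two coordinates of `crossVec a b` contains `a` and `b`: by
`eq_of_div_eq_of_norm_eq_one`, an automorphism that fixes the ratio fixes `a` and `b`. -/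
theorem mem_of_div_mem {K : IntermediateField ℚ Qbar} {a b : Qbar} (ha : IsOfFinOrder a)
    (hb : IsOfFinOrder b) (ha1 : a ≠ 1) (hb1 : b ≠ 1) (hab : a ≠ b) (h : (b - 1) / (a - 1) ∈ K) :
    a ∈ K ∧ b ∈ K := by
  have : IsGalois K Qbar := inferInstance
  obtain ⟨ψ⟩ : Nonempty (Qbar →+* ℂ) :=
    ⟨(IsAlgClosed.lift : Qbar →ₐ[ℚ] ℂ).toRingHom⟩
  have hfix : ∀ τ : Gal(Qbar/K), τ a = a ∧ τ b = b := by
    intro τ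
    have hτ : τ ((b - 1) / (a - 1)) = (b - 1) / (a - 1) := τ.commutes ⟨_, h⟩
    have hτa : τ a ≠ 1 := fun h => ha1 (τ.injective (h.trans (map_one τ).symm))
    have hfo : ∀ {c : Qbar}, IsOfFinOrder c → IsOfFinOrder (τ c) := fun hc =>
      (τ : Qbar →* Qbar).isOfFinOrder hc
    rw [map_div₀, map_sub, map_sub, map_one, div_eq_div_iff (sub_ne_zero.2 hτa) (sub_ne_zero.2 ha1)] at hτ
    have hψ1 : ∀ {c : Qbar}, c ≠ 1 → ψ c ≠ 1 := fun hc h => hc (ψ.injective (h.trans (map_one ψ).symm))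
    have key := eq_of_div_eq_of_norm_eq_one (norm_embedding_eq_one ha ψ) (norm_embedding_eq_one hb ψ)
      (norm_embedding_eq_one (hfo ha) ψ) (norm_embedding_eq_one (hfo hb) ψ) (hψ1 ha1) (hψ1 hb1) (hψ1 hτa)
      (fun h => hab (ψ.injective h)) (by
        have := congrArg ψ hτ
        simp only [map_mul, map_sub, map_one] at this
        exact this.symm)
    exact ⟨ψ.injective key.1, ψ.injective key.2⟩
  constructor
  · obtain ⟨y, hy⟩ := (InfiniteGalois.mem_range_algebraMap_iff_fixed a).2 fun τ : Gal(Qbar/K) => (hfix τ).1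
    exact hy ▸ y.2
  · obtain ⟨y, hy⟩ := (InfiniteGalois.mem_range_algebraMap_iff_fixed b).2 fun τ : Gal(Qbar/K) => (hfix τ).2
    exact hy ▸ y.2

theorem crossVec_ne_zero {a b : Qbar} (h : a ≠ 1 ∨ b ≠ 1) : crossVec a b ≠ 0 := by
  intro h0
  rcases h with h | h
  · exact h (sub_eq_zero.1 (congrFun h0 2))
  · exact h (sub_eq_zero.1 (congrFun h0 1)).symm

/-- The representative chosen in the definition of the height may generate a large field, but this
field contains `a` and `b`, and over it the representative is proportional to `crossVec a b`. -/
theorem weilHeight_mk_crossVec {a b : Qbar} (ha : IsOfFinOrder a)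
    (hb : IsOfFinOrder b) (ha1 : a ≠ 1) (hb1 : b ≠ 1) (hab : a ≠ b) (h0 : crossVec a b ≠ 0) :
    ∃ a' b' : coordField (Projectivization.mk Qbar (crossVec a b) h0).rep,
      (a' : Qbar) = a ∧ (b' : Qbar) = b ∧
      weilHeight (n := 2) (Projectivization.mk Qbar (crossVec a b) h0) =
        Height.logHeight (crossVec a' b') /
          (Module.finrank ℚ (coordField (Projectivization.mk Qbar (crossVec a b) h0).rep) : ℝ) := by
  obtain ⟨c, hc⟩ := Projectivization.exists_smul_eq_mk_rep Qbar (crossVec a b) h0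
  unfold weilHeight vectorHeight
  set x : Fin 3 → Qbar := (Projectivization.mk Qbar (crossVec a b) h0).rep
  have hmem : ∀ i, x i ∈ coordField x := fun i => IntermediateField.subset_adjoin ℚ _ ⟨i, rfl⟩
  have hx : ∀ i, x i = c * crossVec a b i := fun i => by rw [← hc]; rfl
  have hc0 : (c : Qbar) ≠ 0 := c.ne_zero
  have ha0 : a - 1 ≠ 0 := sub_ne_zero.2 ha1
  obtain ⟨haK, hbK⟩ := mem_of_div_mem (K := coordField x) ha hb ha1 hb1 hab (by
    have e : (b - 1) / (a - 1) = -(x 1 / x 2) := by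
      rw [hx, hx]
      simp only [crossVec, Matrix.cons_val]
      field_simp
      ring
    rw [e]
    exact neg_mem (div_mem (hmem 1) (hmem 2)))
  have hcK : (c : Qbar) ∈ coordField x := by
    have e : (c : Qbar) = x 2 / (a - 1) := by
      rw [hx]
      simp only [crossVec, Matrix.cons_val]
      field_simp
    rw [e]
    exact div_mem (hmem 2) (sub_mem haK (one_mem _))
  refine ⟨⟨a, haK⟩, ⟨b, hbK⟩, rfl, rfl, ?_⟩
  congr 1
  rw [← Height.logHeight_smul_eq_logHeight (crossVec (⟨a, haK⟩ : coordField x) ⟨b, hbK⟩)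
    (c := (⟨c, hcK⟩ : coordField x)) (fun h => hc0 (congrArg Subtype.val h))]
  congr 1
  funext i
  apply Subtype.ext
  change x i = c * ((crossVec (⟨a, haK⟩ : coordField x) ⟨b, hbK⟩ i : coordField x) : Qbar)
  rw [hx]
  fin_cases i <;> rfl

/-! ### The intersection of the line with its translate -/

theorem mk_mem_lineC {v : Fin 3 → Qbar} (hv : v ≠ 0) :
    (Projectivization.mk Qbar v hv : ProjSpace 2) ∈ lineC ↔ v 0 + v 1 + v 2 = 0 := by
  constructor
  · intro h
    simpa using h v hv rfl
  · intro h w hw hwv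
    obtain ⟨c, hc⟩ := (Projectivization.mk_eq_mk_iff' Qbar w v hw hv).1 hwv
    simp only [map_add, MvPolynomial.eval_X, ← hc, Pi.smul_apply, smul_eq_mul]
    linear_combination c * h

theorem diagMap_eq (γ : Torus 2) (w : Fin 3 → Qbar) :
    diagMap γ w = ![w 0, γ 0 * w 1, γ 1 * w 2] := by
  funext i
  fin_cases i
  · simp [diagMap]
  · rfl
  · rfl

theorem mk_mem_translation_image_lineC (γ : Torus 2) {v : Fin 3 → Qbar} (hv : v ≠ 0) :
    (Projectivization.mk Qbar v hv : ProjSpace 2) ∈ translation γ '' lineC ↔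
      v 0 + ((γ 0)⁻¹ : Qbarˣ) * v 1 + ((γ 1)⁻¹ : Qbarˣ) * v 2 = 0 := by
  constructor
  · rintro ⟨p, hp, hpv⟩
    induction p using Projectivization.ind with
    | h w hw =>
      rw [mk_mem_lineC] at hp
      obtain ⟨c, hc⟩ := (Projectivization.mk_eq_mk_iff' Qbar (diagMap γ w) v
        (fun h0 => hw (diagMap_injective γ (h0.trans (map_zero _).symm))) hv).1 hpv
      rw [diagMap_eq] at hc
      have e0 : c * v 0 = w 0 := congrFun hc 0
      have e1 : c * v 1 = γ 0 * w 1 := congrFun hc 1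
      have e2 : c * v 2 = γ 1 * w 2 := congrFun hc 2
      have hc0 : c ≠ 0 := by
        rintro rfl
        refine hw ?_
        rw [zero_smul] at hc
        refine diagMap_injective γ ?_
        rw [map_zero, diagMap_eq, ← hc]
      have i0 := Units.inv_mul (γ 0)
      have i1 := Units.inv_mul (γ 1)
      apply (mul_eq_zero.1 _).resolve_left hc0
      linear_combination hp + e0 + (((γ 0)⁻¹ : Qbarˣ) : Qbar) * e1 + (((γ 1)⁻¹ : Qbarˣ) : Qbar) * e2 +
        i0 * w 1 + i1 * w 2
  · intro h
    set w : Fin 3 → Qbar := ![v 0, ((γ 0)⁻¹ : Qbarˣ) * v 1, ((γ 1)⁻¹ : Qbarˣ) * v 2] with hwdef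
    have hdw : diagMap γ w = v := by
      rw [diagMap_eq]
      funext i
      fin_cases i <;> simp [w]
    have hw : w ≠ 0 := fun h0 => hv (by rw [← hdw, h0, map_zero])
    refine ⟨Projectivization.mk Qbar w hw, (mk_mem_lineC hw).2 h, ?_⟩
    change Projectivization.mk Qbar (diagMap γ w) _ = _
    simp only [hdw]

theorem exists_smul_crossVec_eq_iff {F : Type*} [Field F] {a b : F} (hab : a ≠ 1 ∨ b ≠ 1) {v : Fin 3 → F} :
    (∃ c : F, c • crossVec a b = v) ↔ v 0 + v 1 + v 2 = 0 ∧ v 0 + a * v 1 + b * v 2 = 0 := by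
  constructor
  · rintro ⟨c, rfl⟩
    simp only [crossVec, Pi.smul_apply, smul_eq_mul, Matrix.cons_val]
    constructor <;> ring
  · rintro ⟨h1, h2⟩
    have ext3 : ∀ c : F, c * (b - a) = v 0 → c * (1 - b) = v 1 → c * (a - 1) = v 2 →
        c • crossVec a b = v := by
      intro c e0 e1 e2
      funext i
      fin_cases i
      · exact e0
      · exact e1
      · exact e2
    by_cases ha : a = 1
    · have hb : 1 - b ≠ 0 := sub_ne_zero.2 (hab.resolve_left (not_not.2 ha)).symm
      have hc : v 1 / (1 - b) * (1 - b) = v 1 := div_mul_cancel₀ _ hb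
      have h3 : v 2 = 0 := by
        apply (mul_eq_zero.1 _).resolve_left hb
        linear_combination h1 - h2 + v 1 * ha
      refine ⟨_, ext3 _ ?_ hc ?_⟩
      · linear_combination -hc - v 1 / (1 - b) * ha - h1 + h3
      · linear_combination v 1 / (1 - b) * ha - h3
    · have ha' : a - 1 ≠ 0 := sub_ne_zero.2 ha
      have hc : v 2 / (a - 1) * (a - 1) = v 2 := div_mul_cancel₀ _ ha'
      have e1 : v 2 / (a - 1) * (1 - b) = v 1 := by
        apply mul_left_cancel₀ ha'
        linear_combination (1 - b) * hc - h2 + h1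
      refine ⟨_, ext3 _ ?_ e1 hc⟩
      linear_combination -e1 - hc - h1

theorem lineC_inter_translation (γ : Torus 2)
    (hγ : (((γ 0)⁻¹ : Qbarˣ) : Qbar) ≠ 1 ∨ (((γ 1)⁻¹ : Qbarˣ) : Qbar) ≠ 1) :
    lineC ∩ translation γ '' lineC = {Projectivization.mk Qbar _ (crossVec_ne_zero hγ)} := by
  ext p
  induction p using Projectivization.ind with
  | h v hv =>
    rw [Set.mem_inter_iff, mk_mem_lineC, mk_mem_translation_image_lineC, Set.mem_singleton_iff,
      Projectivization.mk_eq_mk_iff', exists_smul_crossVec_eq_iff hγ]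

/-! ### Strict sequences -/

open Filter in
/-- The relation `γ₀ ^ m γ₁ ^ n = 1` defines a proper algebraic subgroup. Negative exponents are
moved to the other side to get a polynomial equation. -/
theorem IsStrict.eventually_ne {γ : ℕ → Torus 2} (h : IsStrict γ) {m n : ℤ} (hmn : m ≠ 0 ∨ n ≠ 0) :
    ∀ᶠ ℓ in atTop, γ ℓ 0 ^ m * γ ℓ 1 ^ n ≠ 1 := by
  let f : Torus 2 →* Qbarˣ :=
    { toFun := fun γ => γ 0 ^ m * γ 1 ^ n
      map_one' := by simp
      map_mul' := fun γ δ => by simp only [Pi.mul_apply, mul_zpow]; exact mul_mul_mul_comm _ _ _ _ }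
  have hf : ∀ γ, f γ = γ 0 ^ m * γ 1 ^ n := fun γ => rfl
  have halg : IsAlgebraicSubgroup f.ker := by
    refine ⟨{MvPolynomial.X 0 ^ m.toNat * MvPolynomial.X 1 ^ n.toNat -
      MvPolynomial.X 0 ^ (-m).toNat * MvPolynomial.X 1 ^ (-n).toNat}, ?_⟩
    ext γ
    have e : ∀ (k : ℤ) (u : Qbarˣ), u ^ k = u ^ k.toNat / u ^ (-k).toNat := fun k u => by
      rw [← zpow_natCast, ← zpow_natCast, div_eq_mul_inv, ← zpow_sub, Int.toNat_sub_toNat_neg]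
    simp only [SetLike.mem_coe, MonoidHom.mem_ker, hf, Set.mem_ofPred_eq, Set.mem_singleton_iff, forall_eq,
      map_sub, map_mul, map_pow, MvPolynomial.eval_X, sub_eq_zero]
    rw [e m, e n, div_mul_div_comm, div_eq_one]
    exact_mod_cast Iff.rfl
  have hproper : f.ker ≠ ⊤ := by
    intro htop
    have h2 : ∀ k : ℤ, (Units.mk0 (2 : Qbar) two_ne_zero) ^ k = 1 → k = 0 := by
      intro k hk
      have h3 : (2 : Qbar) ^ k = 1 := by
        have := congrArg Units.val hk
        simpa using this
      have h4 : ((2 : ℚ) ^ k : ℚ) = 1 := by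
        apply (algebraMap ℚ Qbar).injective
        simpa using h3
      exact (zpow_eq_one_iff_right₀ (by norm_num) (by norm_num)).1 h4
    have hall : ∀ δ : Torus 2, δ 0 ^ m * δ 1 ^ n = 1 := fun δ => by
      have : δ ∈ f.ker := htop ▸ Subgroup.mem_top δ
      exact this
    rcases hmn with hm | hn
    · exact hm (h2 m (by simpa using hall ![Units.mk0 2 two_ne_zero, 1]))
    · exact hn (h2 n (by simpa using hall ![1, Units.mk0 2 two_ne_zero]))
  obtain ⟨ℓ₀, hℓ₀⟩ := h f.ker halg hproper
  filter_upwards [eventually_ge_atTop ℓ₀] with ℓ hℓ h1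
  exact hℓ₀ ℓ hℓ h1

theorem theorem5p1 (ω : ℕ → Torus 2)
    (htors : ∀ ℓ, IsOfFinOrder (ω ℓ)) (hnontriv : ∀ ℓ, ω ℓ ≠ 1) (hstrict : IsStrict ω) :
    ∃ η : ℝ, (η : ℂ) = 2 * riemannZeta 3 / (3 * riemannZeta 2) ∧
      0.487175 ≤ η ∧ η < 0.487176 ∧
      ∃ P : ℕ → ProjSpace 2,
        (∀ ℓ, lineC ∩ translation (ω ℓ) '' lineC = {P ℓ}) ∧
        Filter.Tendsto (fun ℓ => weilHeight (P ℓ)) Filter.atTop (𝓝 η) := by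
  set a : ℕ → Qbar := fun ℓ => ((ω ℓ 0)⁻¹ : Qbarˣ) with hadef
  set b : ℕ → Qbar := fun ℓ => ((ω ℓ 1)⁻¹ : Qbarˣ) with hbdef
  have hfo : ∀ ℓ i, IsOfFinOrder (((ω ℓ i)⁻¹ : Qbarˣ) : Qbar) := fun ℓ i =>
    (Units.coeHom Qbar).isOfFinOrder ((Pi.evalMonoidHom (fun _ => Qbarˣ) i).isOfFinOrder (htors ℓ)).inv
  have hab : ∀ ℓ, a ℓ ≠ 1 ∨ b ℓ ≠ 1 := fun ℓ => by
    by_contra! hab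
    refine hnontriv ℓ ?_
    funext i
    fin_cases i
    · simpa [hadef] using hab.1
    · simpa [hbdef] using hab.2
  have hne : ∀ m n : ℤ, (m ≠ 0 ∨ n ≠ 0) → ∀ᶠ ℓ in Filter.atTop, a ℓ ^ m * b ℓ ^ n ≠ 1 := by
    intro m n hmn
    filter_upwards [hstrict.eventually_ne hmn] with ℓ hℓ h
    refine hℓ (inv_eq_one.1 (Units.ext ?_))
    rw [mul_inv, ← inv_zpow, ← inv_zpow]
    simpa [hadef, hbdef] using h
  -- From some index on, `1`, `a` and `b` are distinct, as `weilHeight_mk_crossVec` requires.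
  obtain ⟨N, hN⟩ := Filter.eventually_atTop.1
    ((hne 1 0 (Or.inl one_ne_zero)).and ((hne 0 1 (Or.inr one_ne_zero)).and
      (hne 1 (-1) (Or.inl one_ne_zero))))
  have hN' : ∀ ℓ, a (ℓ + N) ≠ 1 ∧ b (ℓ + N) ≠ 1 ∧ a (ℓ + N) ≠ b (ℓ + N) := fun ℓ => by
    obtain ⟨h1, h2, h3⟩ := hN (ℓ + N) (Nat.le_add_left _ _)
    refine ⟨by simpa using h1, by simpa using h2, fun h => h3 ?_⟩
    rw [h, zpow_one, zpow_neg_one, mul_inv_cancel₀]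
    exact Units.ne_zero _
  refine ⟨_, two_mul_riemannZeta_three_div, eta_bounds.1, eta_bounds.2,
    fun ℓ => Projectivization.mk Qbar _ (crossVec_ne_zero (hab ℓ)),
    fun ℓ => lineC_inter_translation (ω ℓ) (hab ℓ), ?_⟩
  rw [← Filter.tendsto_add_atTop_iff_nat N]
  choose a' b' ha' hb' hw using fun ℓ => weilHeight_mk_crossVec (hfo (ℓ + N) 0) (hfo (ℓ + N) 1) (hN' ℓ).1
    (hN' ℓ).2.1 (hN' ℓ).2.2 (crossVec_ne_zero (hab (ℓ + N)))
  have hfo' : ∀ {K : IntermediateField ℚ Qbar} {x : K}, IsOfFinOrder (x : Qbar) → IsOfFinOrder x := by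
    intro K x hx
    obtain ⟨n, hn, h⟩ := isOfFinOrder_iff_pow_eq_one.1 hx
    exact isOfFinOrder_iff_pow_eq_one.2 ⟨n, hn, Subtype.ext h⟩
  refine (tendsto_logHeight_crossVec (a := a') (b := b') (fun ℓ => hfo' ?_) (fun ℓ => hfo' ?_) ?_).congr
    fun ℓ => (hw ℓ).symm
  · rw [ha']; exact hfo _ _
  · rw [hb']; exact hfo _ _
  · intro m n hmn
    filter_upwards [(Filter.tendsto_add_atTop_nat N).eventually (hne m n hmn)] with ℓ hℓ h
    refine hℓ ?_
    simpa only [map_mul, map_zpow₀, map_one, IntermediateField.coe_val, ha', hb'] using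
      congrArg (IntermediateField.val _) h
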